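/- **Setting.** Let $d\ge 1$, let $\mathcal V\subset\mathbb R^d$ be finite and let $\gamma>0$ be such that $p(\pm e_j,v)=\gamma\pm\frac12\,e_j\cdot v\ge 0$ for all $v\in\mathcal V$, $1\le j\le d$. Let $\mathcal Q\subset\{(v,w,v',w')\in\mathcal V^4: v+w=v'+w'\}$ be such that $(v,w,v',w')\in\mathcal Q$ implies $(v,w,w',v'),(v',w',v,w),(v',w',w,v)\in\mathcal Q$. Configurations are $\eta\in X=\{0,1\}^{\mathbb Z^d\times\mathcal V}$; put $\xi(x,v)=\eta(x,v)-\frac12$ and $\Psi_A=\prod_{(x,v)\in A}\xi(x,v)$ for finite $A\subset\mathbb Z^d\times\mathcal V$. Every local function $f$ on $X$ (one that depends on finitely many coordinates) is uniquely a finite sum $f=\sum_A\mathfrak f(A)\Psi_A$. On local functions let $$\mathcal L^{ex}f(\eta)=\sum_{v\in\mathcal V}\ \sum_{e\in\{\pm e_1,\dots,\pm e_d\}}\ \sum_{x\in\mathbb Z^d}\eta(x,v)\,[1-\eta(x+e,v)]\,p(e,v)\,[f(\eta^{x,x+e,v})-f(\eta)],$$ where $\eta^{x,y,v}$ is $\eta$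 with the values at $(x,v)$ and $(y,v)$ exchanged, and let $$\mathcal L^c_1f=\frac14\sum_{x\in\mathbb Z^d}\sum_{q\in\mathcal Q}\Big(-4\,\frac{\langle f,\phi_{x,q}\rangle_x}{\langle\phi_{x,q},\phi_{x,q}\rangle_x}\,\phi_{x,q}\Big),\qquad \phi_{x,q}=\xi(x,v')+\xi(x,w')-\xi(x,v)-\xi(x,w)$$ for $q=(v,w,v',w')$, where $\langle\cdot,\cdot\rangle_x$ integrates only the variables $\eta(x,\cdot)$, with respect to the uniform measure on $\{0,1\}^{\mathcal V}$, and the terms with $\phi_{x,q}=0$ are $0$. For local functions $f=\sum_A\mathfrak f(A)\Psi_A$ and $g=\sum_A\mathfrak g(A)\Psi_A$ let $$\ll f,g\gg\;=\;\sum_{n\ge 1}4^{-n}\sum_{A\in\tilde{\mathcal E}_n}\bar{\mathfrak f}(A)\,\bar{\mathfrak g}(A),\qquad \bar{\mathfrak f}(A)=\sum_{z\in\mathbb Z^d}\mathfrak f(A+z),$$ where $\tilde{\mathcal E}_n$ is the set of $n$-point subsets of $\mathbb Z^d\times\mathcal V$ modulo translations by $\mathbb Z^d$ (this is $\sum_{x}\mathrm{Cov}(f,\tau_xg)$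 under the uniform product measure on $X$). Let $\mathcal H$ be the Hilbert space of functions on $\bigcup_{n\ge1}\tilde{\mathcal E}_n$ with the corresponding weighted $\ell^2$ norm, in which the classes $\bar{\mathfrak f}$ of local functions are dense; let $\mathcal L^{ex}+\mathcal L^c_1$ also denote the closure in $\mathcal H$ of this operator, defined first on classes of local functions. Let $P_n$ be the orthogonal projection of $\mathcal H$ onto the functions supported on $\bigcup_{1\le k\le n}\tilde{\mathcal E}_k$, and let $\mathcal L_n=P_n(\mathcal L^{ex}+\mathcal L^c_1)P_n$. For $\theta\in\mathbb R^d$ and $r=(r_0,\dots,r_d)\in\mathbb R^{d+1}$ let $\sigma=\sum_{a=0}^d\sum_{j=1}^d r_a\theta_j\sigma^a_j$, where, with $I_0(v)=1$ and $I_a(v)=e_a\cdot v$ for $1\le a\le d$, $$\sigma^a_j=\gamma\sum_{v\in\mathcal V}I_a(v)\,[\eta(e_j,v)-\eta(0,v)]+\sum_{v\in\mathcal V}(e_j\cdot v)\,I_a(v)\,\xi(e_j,v)\,\xi(0,v).$$ **Lemma.** Let $\lambda>0$. The inverses $(\lambda-\mathcal L^{ex}-\mathcal L^c_1)^{-1}$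 and $(\lambda-\mathcal L_n)^{-1}$, $n\ge 0$, exist as bounded linear operators on $\mathcal H$. The sequence $\ll\sigma,(\lambda-\mathcal L_{2k+1})^{-1}\sigma\gg$, $k\ge 1$, is non-decreasing, the sequence $\ll\sigma,(\lambda-\mathcal L_{2k})^{-1}\sigma\gg$, $k\ge 1$, is non-increasing, and both converge, as $k\to\infty$, to $\ll\sigma,(\lambda-\mathcal L^{ex}-\mathcal L^c_1)^{-1}\sigma\gg$. -/

import Mathlib

/-- The data of a lattice gas in dimension `d`: the finite velocity set `V ⊂ ℝ^d`, the constant `γ`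
of the jump law `p(± e_j, v) = γ ± (1/2) e_j · v` (all these rates being non-negative), and the
symmetric set `Q` of momentum preserving binary collisions `(v, w, v', w')`. -/
structure LatticeGas (d : ℕ) where
  V : Finset (Fin d → ℝ)
  γ : ℝ
  γ_pos : 0 < γ
  rate_nonneg : ∀ v ∈ V, ∀ j : Fin d, 0 ≤ γ + (1 / 2) * v j ∧ 0 ≤ γ - (1 / 2) * v j
  Q : Finset ({v // v ∈ V} × {v // v ∈ V} × {v // v ∈ V} × {v // v ∈ V})
  momentum : ∀ v w v' w' : {v // v ∈ V}, (v, w, v', w') ∈ Q →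
    (v : Fin d → ℝ) + (w : Fin d → ℝ) = (v' : Fin d → ℝ) + (w' : Fin d → ℝ)
  symm : ∀ v w v' w' : {v // v ∈ V}, (v, w, v', w') ∈ Q →
    (v, w, w', v') ∈ Q ∧ (v', w', v, w) ∈ Q ∧ (v', w', w, v) ∈ Q

namespace LatticeGas

noncomputable section

/-! ### Configurations and local functions -/

/-- The velocity set as a type. -/
abbrev Vel {d : ℕ} (M : LatticeGas d) : Type := {v // v ∈ M.V}

/-- The points `(x, v)` of `ℤ^d × V`. -/
abbrev Pt {d : ℕ} (M : LatticeGas d) : Type := (Fin d → ℤ) × M.Vel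

/-- Particle configurations: at most one particle per site and velocity. -/
abbrev Config {d : ℕ} (M : LatticeGas d) : Type := M.Pt → Bool

/-- The occupation number `η(x, v) ∈ {0, 1}`. -/
def occ {d : ℕ} (M : LatticeGas d) (η : M.Config) (p : M.Pt) : ℝ := if η p = true then 1 else 0

/-- The centred occupation number `ξ(x, v) = η(x, v) - 1/2`. -/
def xi {d : ℕ} (M : LatticeGas d) (η : M.Config) (p : M.Pt) : ℝ := M.occ η p - 1 / 2

/-- The local function `Ψ_A = ∏_{(x,v) ∈ A} ξ(x, v)`. -/
def Psi {d : ℕ} (M : LatticeGas d) (A : Finset M.Pt) (η : M.Config) : ℝ := ∏ p ∈ A, M.xi η p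

/-- The local function `∑_A f(A) Ψ_A` with the finitely supported family `f` of Fourier
coefficients. The `Ψ_A` form a basis of the space of local functions, so these are all the local
functions, and `f` is determined by `M.eval f`. -/
def eval {d : ℕ} (M : LatticeGas d) (f : Finset M.Pt →₀ ℝ) (η : M.Config) : ℝ :=
  f.sum fun A c => c * M.Psi A η

/-! ### The generators, acting on local functions

The sums over the lattice have finitely many non-zero terms when `f` is local. -/

/-- The configuration `η^{x,y,v}` in which the values at `(x, v)` and `(y, v)` are exchanged. -/
def exchange {d : ℕ} (M : LatticeGas d) (x y : Fin d → ℤ) (v : M.Vel) (η : M.Config) : M.Config :=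
  fun p => η (Equiv.swap (x, v) (y, v) p)

/-- The rate `p(e, v) = γ + (1/2) e · v` of the unit vector `e = s e_j`, where `s = ± 1`. -/
def jumpRate {d : ℕ} (M : LatticeGas d) (j : Fin d) (s : ℤ) (v : M.Vel) : ℝ :=
  M.γ + (1 / 2) * ((s : ℝ) * (v : Fin d → ℝ) j)

/-- The generator `L^ex` of the asymmetric exclusion dynamics. -/
def genEx {d : ℕ} (M : LatticeGas d) (f : M.Config → ℝ) (η : M.Config) : ℝ :=
  ∑ v : M.Vel, ∑ j : Fin d, ∑ s ∈ ({1, -1} : Finset ℤ), ∑ᶠ x : Fin d → ℤ,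
    M.occ η (x, v) * (1 - M.occ η (x + Pi.single j s, v)) * M.jumpRate j s v *
      (f (M.exchange x (x + Pi.single j s) v η) - f η)

/-- The configuration `η` with the variables at site `x` replaced by `ζ`. -/
def setSite {d : ℕ} (M : LatticeGas d) (x : Fin d → ℤ) (ζ : M.Vel → Bool) (η : M.Config) :
    M.Config :=
  fun p => if p.1 = x then ζ p.2 else η p

/-- The inner product `⟨f, g⟩_x` in which only the variables at the site `x` are integrated, with
respect to the uniform measure on `{0,1}^V`; it is a function of the other variables. -/
def siteInner {d : ℕ} (M : LatticeGas d) (x : Fin d → ℤ) (f g : M.Config → ℝ) (η : M.Config) : ℝ :=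
  (∑ ζ : M.Vel → Bool, f (M.setSite x ζ η) * g (M.setSite x ζ η)) / 2 ^ Fintype.card M.Vel

/-- `φ_{x,q,1} = ξ(x,v') + ξ(x,w') - ξ(x,v) - ξ(x,w)` for the collision `q = (v, w, v', w')`. -/
def phi {d : ℕ} (M : LatticeGas d) (x : Fin d → ℤ) (q : M.Vel × M.Vel × M.Vel × M.Vel)
    (η : M.Config) : ℝ :=
  M.xi η (x, q.2.2.1) + M.xi η (x, q.2.2.2) - M.xi η (x, q.1) - M.xi η (x, q.2.1)

/-- `L_{x,q,1} f = - 4 (⟨f, φ⟩_x / ⟨φ, φ⟩_x) φ` with `φ = φ_{x,q,1}`. It is `0` for the trivial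
collisions `{v, w} = {v', w'}`, for which `φ = 0`. -/
def genCollAt {d : ℕ} (M : LatticeGas d) (x : Fin d → ℤ) (q : M.Vel × M.Vel × M.Vel × M.Vel)
    (f : M.Config → ℝ) (η : M.Config) : ℝ :=
  -4 * (M.siteInner x f (M.phi x q) η / M.siteInner x (M.phi x q) (M.phi x q) η) * M.phi x q η

/-- The degree-one part `L^c_1 = (1/4) ∑_x ∑_{q ∈ Q} L_{x,q,1}` of the collision operator. -/
def genColl {d : ℕ} (M : LatticeGas d) (f : M.Config → ℝ) (η : M.Config) : ℝ :=
  (1 / 4) * ∑ᶠ x : Fin d → ℤ, ∑ q ∈ M.Q, M.genCollAt x q f η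

/-- The operator `L^ex + L^c_1`. -/
def gen {d : ℕ} (M : LatticeGas d) (f : M.Config → ℝ) (η : M.Config) : ℝ :=
  M.genEx f η + M.genColl f η

/-! ### The Hilbert space of the scalar product `≪·,·≫` -/

/-- The translate `A + z` of a finite subset of `ℤ^d × V`. -/
def translate {d : ℕ} (M : LatticeGas d) (z : Fin d → ℤ) (A : Finset M.Pt) : Finset M.Pt :=
  A.map ⟨fun p => (p.1 + z, p.2), fun p q h => by
    simpa [Prod.ext_iff] using h⟩

theorem translate_translate {d : ℕ} (M : LatticeGas d) (z w : Fin d → ℤ) (A : Finset M.Pt) :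
    M.translate z (M.translate w A) = M.translate (w + z) A := by
  simp only [translate, Finset.map_map]
  congr 1
  apply Function.Embedding.ext
  intro p
  exact Prod.ext (add_assoc _ _ _) rfl

theorem translate_zero {d : ℕ} (M : LatticeGas d) (A : Finset M.Pt) :
    M.translate 0 A = A := by
  ext p
  simp [translate]

/-- Two non-empty finite sets are equivalent if one is a translate of the other. -/
instance translateSetoid {d : ℕ} (M : LatticeGas d) : Setoid {A : Finset M.Pt // A.Nonempty} where
  r A B := ∃ z : Fin d → ℤ, (A : Finset M.Pt) = M.translate z B
  iseqv :=
    { refl := fun A => ⟨0, (M.translate_zero A).symm⟩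
      symm := by
        rintro A B ⟨z, h⟩
        exact ⟨-z, by rw [h, translate_translate, add_neg_cancel, translate_zero]⟩
      trans := by
        rintro A B C ⟨z, h⟩ ⟨w, h'⟩
        exact ⟨w + z, by rw [h, h', translate_translate]⟩ }

/-- Non-empty finite subsets of `ℤ^d × V` modulo translations. -/
abbrev Orbit {d : ℕ} (M : LatticeGas d) : Type := Quotient M.translateSetoid

/-- The cardinality of the sets in an orbit. -/
def deg {d : ℕ} (M : LatticeGas d) : M.Orbit → ℕ :=
  Quotient.lift (fun A => (A : Finset M.Pt).card) (by
    rintro A B ⟨z, h⟩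
    simp only [h, translate, Finset.card_map])

/-- The orbit sums `∑_{z ∈ ℤ^d} f(A + z)`. -/
def orbitSum {d : ℕ} (M : LatticeGas d) (f : Finset M.Pt →₀ ℝ) : M.Orbit → ℝ :=
  Quotient.lift (fun A => ∑ᶠ z : Fin d → ℤ, f (M.translate z A)) (by
    rintro A B ⟨w, h⟩
    simp only [h, translate_translate]
    exact finsum_comp_equiv (Equiv.addLeft w) (f := fun z => f (M.translate z B)))

/-- The Hilbert space of square summable functions on the orbits. -/
abbrev Hilb {d : ℕ} (M : LatticeGas d) : Type := lp (fun _ : M.Orbit => ℝ) 2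

theorem memLp_toHilb {d : ℕ} (M : LatticeGas d) (f : Finset M.Pt →₀ ℝ) :
    Memℓp (fun a : M.Orbit => (1 / 2 : ℝ) ^ M.deg a * M.orbitSum f a) 2 := by
  classical
  have h0 : (0 : ENNReal) ≤ 2 := bot_le
  refine Memℓp.of_exponent_ge (memℓp_zero ?_) h0
  refine Set.Finite.subset (((f.support.finite_toSet).preimage
    (Subtype.val_injective.injOn)).image
      (fun A : {A : Finset M.Pt // A.Nonempty} => (Quotient.mk _ A : M.Orbit))) ?_
  intro a ha
  induction a using Quotient.inductionOn with
  | _ A =>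
    have h : (∑ᶠ z : Fin d → ℤ, f (M.translate z A)) ≠ 0 := fun h => ha (by
      show (1 / 2 : ℝ) ^ _ * (∑ᶠ z : Fin d → ℤ, f (M.translate z A)) = 0
      rw [h, mul_zero])
    obtain ⟨z, hz⟩ : ∃ z : Fin d → ℤ, f (M.translate z A) ≠ 0 := by
      by_contra hz
      push Not at hz
      exact h (by simp [hz])
    exact ⟨⟨M.translate z A, by simpa [translate] using A.2⟩, by simpa using hz,
      Quotient.sound ⟨z, rfl⟩⟩

/-- The class of a local function, given by its Fourier coefficients, in the Hilbert space. The
factor `(1/2)^n` is such that the inner product of the classes of `f` and `g` is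
`≪f, g≫ = ∑_{n ≥ 1} (1/4)^n ∑_{|A| = n} (∑_z f(A + z)) (∑_z g(A + z))`, with one summand for each
orbit of sets `A`. -/
def toHilb {d : ℕ} (M : LatticeGas d) (f : Finset M.Pt →₀ ℝ) : M.Hilb :=
  ⟨fun a => (1 / 2 : ℝ) ^ M.deg a * M.orbitSum f a, M.memLp_toHilb f⟩

/-- The orthogonal projection `P_n` on the functions of degree at most `n`. -/
def proj {d : ℕ} (M : LatticeGas d) (n : ℕ) (u : M.Hilb) : M.Hilb :=
  ⟨fun a => if M.deg a ≤ n then u a else 0, by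
    refine memℓp_gen (Summable.of_nonneg_of_le (fun a => by positivity) (fun a => ?_)
      ((lp.memℓp u).summable (by simp)))
    by_cases h : M.deg a ≤ n
    · simp [h]
    · simp only [h, if_false, norm_zero]
      simp [sq_nonneg]⟩

/-! ### Closed operators and resolvents, through graphs -/

/-- The graph of the closure of `L^ex + L^c_1`, defined first on the classes of local functions. -/
def genGraph {d : ℕ} (M : LatticeGas d) : Set (M.Hilb × M.Hilb) :=
  closure {p | ∃ f g : Finset M.Pt →₀ ℝ, M.eval g = M.gen (M.eval f) ∧
    p = (M.toHilb f, M.toHilb g)}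

/-- The graph of the truncated operator `L_n = P_n (L^ex + L^c_1) P_n`. -/
def truncGraph {d : ℕ} (M : LatticeGas d) (n : ℕ) : Set (M.Hilb × M.Hilb) :=
  {p | ∃ w : M.Hilb, (M.proj n p.1, w) ∈ M.genGraph ∧ p.2 = M.proj n w}

/-- `R = (lam - L)⁻¹` for the operator `L` with graph `G`: the equation `lam u - L u = s` has, for
every `s`, the unique solution `u = R s`. -/
def IsResolvent {d : ℕ} (M : LatticeGas d) (G : Set (M.Hilb × M.Hilb)) (lam : ℝ)
    (R : M.Hilb →L[ℝ] M.Hilb) : Prop :=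
  ∀ s u : M.Hilb, (u, lam • u - s) ∈ G ↔ u = R s

/-! ### The current -/

/-- The value at `v` of the conserved quantities: `1` for the mass `I_0`, and `e_a · v` for the
component `I_a` of the momentum, `1 ≤ a ≤ d`. -/
def charge {d : ℕ} (M : LatticeGas d) (a : Fin (d + 1)) (v : M.Vel) : ℝ :=
  (Fin.cons 1 (v : Fin d → ℝ) : Fin (d + 1) → ℝ) a

/-- The local function `I_a(η_x) = ∑_v I_a(v) η(x, v)`. -/
def charges {d : ℕ} (M : LatticeGas d) (a : Fin (d + 1)) (x : Fin d → ℤ) (η : M.Config) : ℝ :=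
  ∑ v : M.Vel, M.charge a v * M.occ η (x, v)

/-- The part `σ^a_j = γ {I_a(η_{e_j}) - I_a(η_0)} + ∑_v (e_j · v) I_a(v) ξ(e_j, v) ξ(0, v)` of the
current that is orthogonal to the conserved quantities. -/
def current {d : ℕ} (M : LatticeGas d) (a : Fin (d + 1)) (j : Fin d) (η : M.Config) : ℝ :=
  M.γ * (M.charges a (Pi.single j 1) η - M.charges a 0 η) +
    ∑ v : M.Vel, (v : Fin d → ℝ) j * M.charge a v *
      (M.xi η (Pi.single j 1, v) * M.xi η (0, v))

/-- The local function `σ = ∑_{a,j} r_a θ_j σ^a_j`. -/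
def sigma {d : ℕ} (M : LatticeGas d) (θ : Fin d → ℝ) (r : Fin (d + 1) → ℝ) (η : M.Config) : ℝ :=
  ∑ a : Fin (d + 1), ∑ j : Fin d, r a * θ j * M.current a j η

/-- The Fourier coefficients of `σ`. -/
def sigmaCoeff {d : ℕ} (M : LatticeGas d) (θ : Fin d → ℝ) (r : Fin (d + 1) → ℝ) :
    Finset M.Pt →₀ ℝ :=
  ∑ a : Fin (d + 1), ∑ j : Fin d, (r a * θ j) • ∑ v : M.Vel,
    (Finsupp.single {(Pi.single j 1, v)} (M.γ * M.charge a v)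
      - Finsupp.single {(0, v)} (M.γ * M.charge a v)
      + Finsupp.single {(Pi.single j 1, v), (0, v)} ((v : Fin d → ℝ) j * M.charge a v))

theorem eval_add {d : ℕ} (M : LatticeGas d) (f g : Finset M.Pt →₀ ℝ) (η : M.Config) :
    M.eval (f + g) η = M.eval f η + M.eval g η :=
  Finsupp.sum_add_index' (by simp) (by intros; ring)

theorem eval_sub {d : ℕ} (M : LatticeGas d) (f g : Finset M.Pt →₀ ℝ) (η : M.Config) :
    M.eval (f - g) η = M.eval f η - M.eval g η :=
  Finsupp.sum_sub_index (by intros; ring)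

theorem eval_smul {d : ℕ} (M : LatticeGas d) (c : ℝ) (f : Finset M.Pt →₀ ℝ) (η : M.Config) :
    M.eval (c • f) η = c * M.eval f η := by
  rw [eval, Finsupp.sum_smul_index (by simp), eval, Finsupp.mul_sum]
  simp only [mul_assoc]

theorem eval_single {d : ℕ} (M : LatticeGas d) (A : Finset M.Pt) (c : ℝ) (η : M.Config) :
    M.eval (Finsupp.single A c) η = c * M.Psi A η :=
  Finsupp.sum_single_index (by simp)

theorem eval_sum {d : ℕ} (M : LatticeGas d) {ι : Type*} (s : Finset ι)
    (f : ι → Finset M.Pt →₀ ℝ) (η : M.Config) :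
    M.eval (∑ i ∈ s, f i) η = ∑ i ∈ s, M.eval (f i) η := by
  classical
  induction s using Finset.induction_on with
  | empty => simp [eval]
  | insert i s hi ih => rw [Finset.sum_insert hi, Finset.sum_insert hi, eval_add, ih]

/-- `M.sigmaCoeff θ r` is indeed the family of Fourier coefficients of `σ`. -/
theorem eval_sigmaCoeff {d : ℕ} (M : LatticeGas d) (θ : Fin d → ℝ) (r : Fin (d + 1) → ℝ) :
    M.eval (M.sigmaCoeff θ r) = M.sigma θ r := by
  funext η
  simp only [sigmaCoeff, sigma, eval_sum, eval_smul]
  refine Finset.sum_congr rfl fun a _ => Finset.sum_congr rfl fun j _ => ?_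
  congr 1
  simp only [current, charges, ← Finset.sum_sub_distrib, Finset.mul_sum, ← Finset.sum_add_distrib]
  refine Finset.sum_congr rfl fun v _ => ?_
  have hne : ((Pi.single j 1, v) : M.Pt) ≠ (0, v) := by
    intro h
    simpa using congrFun (congrArg Prod.fst h) j
  rw [eval_add, eval_sub, eval_single, eval_single, eval_single, Psi, Psi, Psi,
    Finset.prod_pair hne, Finset.prod_singleton, Finset.prod_singleton]
  simp only [xi]
  ring

end

end LatticeGas

/-! Modulo translations the generator is `S + A`, where `S` is symmetric, non-positive and degree
preserving, and `A` is skew and changes the degree by one. Both come from bounded operators, `symOp`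
and `skewOp`, on square summable functions of sets with one marked point. There a jump or a
collision is a weighted permutation with an explicit inverse, and (skew) symmetry is a change of
variables (`inner_wcomp`). A set of n points has n marks, so the lift to marked sets costs a factor
√n, and `S` and `A` have norm O(n) in degree n. `toHilbLin_genCoeff` identifies the result with the
generator L on the basis Ψ_A.

Resolvents: the closed generator is dissipative, so it suffices that λ - L has dense range
(`exists_resolvent`). If w is orthogonal to the range, testing with P_{n+1} w leaves, apart from a
term of good sign, only the skew flux between degrees n+1 and n+2. Hence p_n = ‖P_n w‖² satisfies
p_{n+1} ≤ C (n+1) (p_{n+2} - p_n). The differences are summable and ∑ 1/n diverges, so w = 0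
(`eq_zero_of_orthogonal`, `eq_zero_of_carleman`).

Convergence: for u of bounded degree, (λ - L) u = (λ - L_n) u for all large n. These vectors span a
dense space on which the truncated resolvents are eventually equal to the full one, and all
resolvents are bounded by 1/λ (`tendsto_of_eventually_eq`).

Monotonicity: σ has degree two, so the even part f and the odd part g of a solution satisfy (λ - S)
f - A g = σ and (λ - S) g = A f. Formally, the value ⟨σ, f⟩ at the solution is both sup_f {2⟨σ, f⟩ -
⟨f, (λ - S) f⟩ - ⟨A f, (λ - S)⁻¹ A f⟩} and inf_g {⟨g, (λ - S) g⟩ + ⟨σ + A g, (λ - S)⁻¹ (σ + A g)⟩}.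
Truncation at an odd degree only restricts f in the supremum; truncation at an even degree only
restricts g in the infimum. `inner_le_of_odd_truncation` and `inner_le_of_even_truncation` replace
these formulas by quadratic identities. -/

section HilbertTools

/-! ### Dissipative relations, resolvents and their strong convergence -/

variable {H : Type*} [NormedAddCommGroup H] [InnerProductSpace ℝ H]

/-- For a dissipative relation, the resolvent equation bounds the solution. -/
theorem norm_le_of_dissipative {lam : ℝ} {u s : H} (h : inner ℝ u (lam • u - s) ≤ 0) :
    lam * ‖u‖ ≤ ‖s‖ := by
  rw [inner_sub_right, inner_smul_right, real_inner_self_eq_norm_sq] at h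
  have h1 := real_inner_le_norm u s
  rcases (norm_nonneg u).eq_or_lt' with h0 | h0
  · rw [h0, mul_zero]; exact norm_nonneg _
  · nlinarith

/-- A closed dissipative linear relation `G` for which `lam - G` has trivial orthogonal complement
of its range has a bounded resolvent at `lam`. -/
theorem exists_resolvent [CompleteSpace H] (G : Submodule ℝ (H × H))
    (hcl : IsClosed (G : Set (H × H))) (hdiss : ∀ p ∈ G, inner ℝ p.1 p.2 ≤ 0) {lam : ℝ}
    (hlam : 0 < lam)
    (hran : ∀ w : H, (∀ p ∈ G, inner ℝ w (lam • p.1 - p.2) = 0) → w = 0) :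
    ∃ R : H →L[ℝ] H, ∀ s u : H, (u, lam • u - s) ∈ G ↔ u = R s := by
  have : CompleteSpace G := hcl.completeSpace_coe
  let Φ : G →L[ℝ] H := (lam • ContinuousLinearMap.fst ℝ H H - ContinuousLinearMap.snd ℝ H H).comp
    G.subtypeL
  have hΦ : ∀ p : G, Φ p = lam • p.1.1 - p.1.2 := fun p => rfl
  have hb1 : ∀ p : G, lam * ‖p.1.1‖ ≤ ‖Φ p‖ := fun p => by
    apply norm_le_of_dissipative
    rw [hΦ, sub_sub_cancel]
    exact hdiss p.1 p.2
  have hb2 : ∀ p : G, ‖p.1.2‖ ≤ 2 * ‖Φ p‖ := fun p => by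
    have : p.1.2 = lam • p.1.1 - Φ p := by rw [hΦ, sub_sub_cancel]
    rw [this]
    refine (norm_sub_le _ _).trans ?_
    rw [norm_smul, Real.norm_of_nonneg hlam.le]
    linarith [hb1 p]
  -- The product carries the maximum norm; `hb1` controls the first component by 1/lam and `hb2` the
  -- second by 2.
  have hanti : AntilipschitzWith (Real.toNNReal (1 / lam + 2)) Φ := by
    refine ContinuousLinearMap.antilipschitz_of_bound Φ fun p => ?_
    rw [Real.coe_toNNReal _ (by positivity)]
    have h3 : ‖p.1.1‖ ≤ 1 / lam * ‖Φ p‖ := by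
      rw [one_div, ← div_eq_inv_mul, le_div_iff₀ hlam]
      linarith [hb1 p]
    have h4 : 0 ≤ 1 / lam * ‖Φ p‖ := by positivity
    have h5 := norm_nonneg (Φ p)
    change ‖(p : H × H)‖ ≤ _
    rw [Prod.norm_def]
    refine max_le ?_ ?_
    · linarith
    · linarith [hb2 p]
  have hclr : IsClosed (Φ.range : Set H) := by
    have := hanti.isClosed_range Φ.uniformContinuous
    exact this
  have hker : Φ.ker = ⊥ := LinearMap.ker_eq_bot.mpr hanti.injective
  have hrange : Φ.range = ⊤ := by
    have : CompleteSpace Φ.range := hclr.completeSpace_coe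
    rw [← Submodule.orthogonal_eq_bot_iff, Submodule.eq_bot_iff]
    intro w hw
    refine hran w fun p hp => ?_
    rw [Submodule.mem_orthogonal'] at hw
    exact hw _ ⟨⟨p, hp⟩, rfl⟩
  let e := ContinuousLinearEquiv.ofBijective Φ hker hrange
  have he : ∀ p, e p = Φ p := fun p => rfl
  refine ⟨(ContinuousLinearMap.fst ℝ H H).comp (G.subtypeL.comp e.symm.toContinuousLinearMap),
    fun s u => ⟨fun h => ?_, fun h => ?_⟩⟩
  · have : e ⟨(u, lam • u - s), h⟩ = s := by rw [he, hΦ]; simp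
    rw [← this]
    simp
  · have h1 : Φ (e.symm s) = s := by rw [← he]; simp
    have h2 : u = (e.symm s).1.1 := h
    have h3 : (u, lam • u - s) = ((e.symm s : G) : H × H) := by
      refine Prod.ext h2 ?_
      change lam • u - s = (e.symm s).1.2
      rw [hΦ] at h1
      rw [h2, sub_eq_iff_eq_add, ← sub_eq_iff_eq_add', h1]
    rw [h3]
    exact (e.symm s).2

/-- A bounded dissipative operator has bounded resolvents. -/
theorem exists_resolvent_of_bounded [CompleteSpace H] (T : H →L[ℝ] H)
    (hT : ∀ u, inner ℝ u (T u) ≤ 0) {lam : ℝ} (hlam : 0 < lam) :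
    ∃ R : H →L[ℝ] H, ∀ s u : H, lam • u - s = T u ↔ u = R s := by
  have hcl : IsClosed ((T : H →ₗ[ℝ] H).graph : Set (H × H)) := by
    have : ((T : H →ₗ[ℝ] H).graph : Set (H × H)) = {p | p.2 = T p.1} := by
      ext p; simp [LinearMap.mem_graph_iff]
    rw [this]
    exact isClosed_eq continuous_snd (T.continuous.comp continuous_fst)
  have hdiss : ∀ p ∈ (T : H →ₗ[ℝ] H).graph, inner ℝ p.1 p.2 ≤ 0 := by
    rintro p hp
    rw [LinearMap.mem_graph_iff] at hp
    rw [hp]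
    exact hT _
  obtain ⟨R, hR⟩ := exists_resolvent _ hcl hdiss hlam fun w hw => by
    have := hw (w, T w) (by simp [LinearMap.mem_graph_iff])
    rw [inner_sub_right, inner_smul_right, real_inner_self_eq_norm_sq] at this
    have h1 := hT w
    have h2 : ‖w‖ ^ 2 ≤ 0 := by
      by_contra h
      push Not at h
      nlinarith
    have h3 : ‖w‖ = 0 := by nlinarith [norm_nonneg w]
    exact norm_eq_zero.mp h3
  refine ⟨R, fun s u => ?_⟩
  rw [← hR, LinearMap.mem_graph_iff, ContinuousLinearMap.coe_coe]

/-- Uniformly bounded operators that are eventually equal to `R` on a set with dense span converge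
strongly to `R`. -/
theorem tendsto_of_eventually_eq [CompleteSpace H] {Rn : ℕ → H →L[ℝ] H} {R : H →L[ℝ] H} {C : ℝ}
    (hRn : ∀ n s, ‖Rn n s‖ ≤ C * ‖s‖) (hR : ∀ s, ‖R s‖ ≤ C * ‖s‖) (D : Submodule ℝ H)
    (hD : Dᗮ = ⊥) (hDR : ∀ h ∈ D, ∃ N, ∀ n ≥ N, Rn n h = R h) (s : H) :
    Filter.Tendsto (fun n => Rn n s) Filter.atTop (nhds (R s)) := by
  rw [Metric.tendsto_atTop]
  intro ε hε
  have hC : 0 < 2 * |C| + 1 := by positivity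
  have hdense : Dense (D : Set H) := Submodule.dense_iff_topologicalClosure_eq_top.mpr
    ((Submodule.topologicalClosure_eq_top_iff).mpr hD)
  obtain ⟨h, hh, hsh⟩ := Metric.dense_iff.mp hdense s (ε / (2 * |C| + 1)) (by positivity)
  rw [Metric.mem_ball, dist_eq_norm] at hh
  obtain ⟨N, hN⟩ := hDR h hsh
  refine ⟨N, fun n hn => ?_⟩
  have e1 : Rn n s - R s = R (h - s) - Rn n (h - s) := by
    rw [map_sub, map_sub, hN n hn]; abel
  have hle : ∀ x : H, C * ‖x‖ ≤ |C| * ‖x‖ := fun x => by gcongr; exact le_abs_self C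
  rw [dist_eq_norm, e1]
  calc ‖R (h - s) - Rn n (h - s)‖ ≤ ‖R (h - s)‖ + ‖Rn n (h - s)‖ := norm_sub_le _ _
    _ ≤ |C| * ‖h - s‖ + |C| * ‖h - s‖ :=
      add_le_add ((hR _).trans (hle _)) ((hRn _ _).trans (hle _))
    _ ≤ (2 * |C| + 1) * ‖h - s‖ := by nlinarith [norm_nonneg (h - s)]
    _ < ε := by rwa [lt_div_iff₀' hC] at hh

/-! ### Comparison of truncated resolvents -/

/-- Comparison of two resolvents of block tridiagonal truncations: if the equation of the smaller
system for the component `g` is not affected by the truncation, its quadratic form is smaller. -/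
theorem inner_le_of_odd_truncation {S A : H →L[ℝ] H} (hS : ∀ x y, inner ℝ (S x) y = inner ℝ x (S y))
    (hS0 : ∀ x, inner ℝ x (S x) ≤ 0) (hA : ∀ x y, inner ℝ (A x) y = -inner ℝ x (A y)) {lam : ℝ}
    (hlam : 0 ≤ lam) {σ f g f' g' k : H}
    (h1 : lam • f' - S f' - A g' = σ) (h2 : lam • g' - S g' - A f' = 0)
    (h3 : lam • f - S f - k = σ) (h4 : lam • g - S g - A f = 0)
    (hk : inner ℝ k f = inner ℝ (A g) f) : inner ℝ σ f ≤ inner ℝ σ f' := by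
  -- Put E(x) = ⟨x, (lam - S) x⟩. The energy identities `p1`–`p4` give ⟨σ, f'⟩ = E(f') + E(g') and
  -- ⟨σ, f⟩ = E(f) + E(g). The cross terms `p5`, `p6` add up to ⟨σ, f⟩, because `h1` and `h4`
  -- contain the full `A`. Therefore ⟨σ, f'⟩ - ⟨σ, f⟩ = E(f' - f) + E(g' - g) ≥ 0.
  have p1 := congrArg (fun x => inner ℝ x f') h1
  have p2 := congrArg (fun x => inner ℝ x g') h2
  have p3 := congrArg (fun x => inner ℝ x f) h3
  have p4 := congrArg (fun x => inner ℝ x g) h4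
  have p5 := congrArg (fun x => inner ℝ x f) h1
  have p6 := congrArg (fun x => inner ℝ x g') h4
  have q1 := hS0 (f' - f)
  have q2 := hS0 (g' - g)
  have n1 := real_inner_self_nonneg (x := f' - f)
  have n2 := real_inner_self_nonneg (x := g' - g)
  simp only [inner_sub_left, inner_sub_right, inner_smul_left, map_sub, RCLike.conj_to_real,
    inner_zero_left, hk] at p1 p2 p3 p4 p5 p6 q1 q2 n1 n2
  have a1 := hA g' f'
  have a2 := hA g f
  have a3 := hA g' f
  have s1 := hS f' f
  have s2 := hS g' g
  have s3 := hS f f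
  have s4 := hS f' f'
  have s5 := hS g g
  have s6 := hS g' g'
  have s7 := hS f f'
  have s8 := hS g g'
  have c1 := real_inner_comm f f'
  have c2 := real_inner_comm g g'
  have c3 := real_inner_comm g' (A f)
  have c4 := real_inner_comm g (A f)
  have c5 := real_inner_comm g' (A f')
  have c6 := real_inner_comm f (S f')
  have c7 := real_inner_comm g (S g')
  have m1 := mul_nonneg hlam n1
  have m2 := mul_nonneg hlam n2
  rw [c1] at m1 p5
  rw [c2] at m2
  simp only [mul_sub] at m1 m2
  linarith

/-- Comparison of two resolvents of block tridiagonal truncations: if the equation of the smaller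
system for the component `f` is not affected by the truncation, its quadratic form is larger. -/
theorem inner_le_of_even_truncation {S A : H →L[ℝ] H}
    (hS : ∀ x y, inner ℝ (S x) y = inner ℝ x (S y))
    (hS0 : ∀ x, inner ℝ x (S x) ≤ 0) (hA : ∀ x y, inner ℝ (A x) y = -inner ℝ x (A y)) {lam : ℝ}
    (hlam : 0 ≤ lam) {σ f g f' g' k : H}
    (h1 : lam • f' - S f' - A g' = σ) (h2 : lam • g' - S g' - A f' = 0)
    (h3 : lam • f - S f - A g = σ) (h4 : lam • g - S g - k = 0)
    (hk : inner ℝ k g = inner ℝ (A f) g) : inner ℝ σ f' ≤ inner ℝ σ f := by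
  -- Now `h3` and `h2` contain the full `A`, and the cross terms `p5`, `p6` add up to ⟨σ, f'⟩
  -- instead. The same energies then give ⟨σ, f⟩ - ⟨σ, f'⟩ = E(f' - f) + E(g' - g).
  have p1 := congrArg (fun x => inner ℝ x f') h1
  have p2 := congrArg (fun x => inner ℝ x g') h2
  have p3 := congrArg (fun x => inner ℝ x f) h3
  have p4 := congrArg (fun x => inner ℝ x g) h4
  have p5 := congrArg (fun x => inner ℝ x f') h3
  have p6 := congrArg (fun x => inner ℝ x g) h2
  have q1 := hS0 (f' - f)
  have q2 := hS0 (g' - g)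
  have n1 := real_inner_self_nonneg (x := f' - f)
  have n2 := real_inner_self_nonneg (x := g' - g)
  simp only [inner_sub_left, inner_sub_right, inner_smul_left, map_sub, RCLike.conj_to_real,
    inner_zero_left, hk] at p1 p2 p3 p4 p5 p6 q1 q2 n1 n2
  have a1 := hA g' f'
  have a2 := hA g f
  have a3 := hA g f'
  have s1 := hS f' f
  have s2 := hS g' g
  have s3 := hS f f
  have s4 := hS f' f'
  have s5 := hS g g
  have s6 := hS g' g'
  have s7 := hS f f'
  have s8 := hS g g'
  have c1 := real_inner_comm f f'
  have c2 := real_inner_comm g g'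
  have c3 := real_inner_comm g (A f')
  have c4 := real_inner_comm g (A f)
  have c5 := real_inner_comm g' (A f')
  have c6 := real_inner_comm f (S f')
  have c7 := real_inner_comm g (S g')
  have m1 := mul_nonneg hlam n1
  have m2 := mul_nonneg hlam n2
  rw [c1] at m1
  rw [c2] at m2 p6
  simp only [mul_sub] at m1 m2
  linarith

/-! ### A criterion from the divergence of the harmonic series -/

/-- A non-decreasing bounded sequence that vanishes as soon as its increments dominate `p n / n`. -/
theorem eq_zero_of_carleman {p : ℕ → ℝ} (hp : Monotone p) (h0 : ∀ n, 0 ≤ p n) {B : ℝ}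
    (hB : ∀ n, p n ≤ B) {C : ℝ}
    (h : ∀ n, p (n + 1) ≤ C * (n + 1) * (p (n + 2) - p n)) (n : ℕ) : p n = 0 := by
  by_contra hn
  have hpos : 0 < p n := lt_of_le_of_ne (h0 n) (Ne.symm hn)
  -- Differences over two steps telescope to two boundary terms at each end, whence the bound 2B.
  have hs : Summable fun k : ℕ => C * (p (n + k + 2) - p (n + k)) := by
    refine Summable.mul_left _ (summable_of_sum_range_le (c := 2 * B) (fun k => ?_) fun m => ?_)
    · exact sub_nonneg.mpr (hp (by omega))
    · have : ∀ m : ℕ, ∑ i ∈ Finset.range m, (p (n + i + 2) - p (n + i)) =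
          p (n + m + 1) + p (n + m) - p (n + 1) - p n := by
        intro m
        induction m with
        | zero => simp
        | succ m ih =>
          rw [Finset.sum_range_succ, ih]
          have e1 : n + (m + 1) + 1 = n + m + 2 := by ring
          have e2 : n + (m + 1) = n + m + 1 := by ring
          rw [e1, e2]
          ring
      rw [this]
      linarith [hB (n + m + 1), hB (n + m), h0 (n + 1), h0 n]
  have hs2 : Summable fun k : ℕ => p n * (1 / ((k + (n + 1) : ℕ) : ℝ)) := by
    refine Summable.of_nonneg_of_le (fun k => by positivity) (fun k => ?_) hs
    rw [mul_one_div, div_le_iff₀ (by positivity)]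
    have h1 := h (n + k)
    have h2 : p n ≤ p (n + k + 1) := hp (by omega)
    push_cast at h1 ⊢
    calc p n ≤ _ := h2
      _ ≤ _ := h1
      _ = _ := by ring
  have hs3 := (summable_mul_left_iff hpos.ne').mp hs2
  rw [summable_nat_add_iff (f := fun k : ℕ => 1 / (k : ℝ)) (n + 1)] at hs3
  exact Real.not_summable_one_div_natCast hs3

end HilbertTools

/-! ### Weighted pullbacks on `ℓ²` -/

section Pullback

variable {ι κ : Type*}

/-- Group the indices by their image under `g`: each `u o ^ 2` is counted with total weight at most
`C`. -/
theorem sum_sq_pull_le (g : κ → ι) (c : κ → ℝ) {C : ℝ}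
    (hC : ∀ o (s : Finset κ), (∀ k ∈ s, g k = o) → ∑ k ∈ s, c k ^ 2 ≤ C)
    (u : lp (fun _ : ι => ℝ) 2) (t : Finset κ) :
    ∑ k ∈ t, (c k * u (g k)) ^ 2 ≤ C * ‖u‖ ^ 2 := by
  classical
  -- The fibre condition forces `0 ≤ C` unless `ι` is empty, and then `u = 0`.
  have hC0 : 0 ≤ C ∨ t = ∅ := by
    rcases t.eq_empty_or_nonempty with h | ⟨k, hk⟩
    · exact Or.inr h
    · exact Or.inl (le_trans (by positivity) (hC (g k) {k} (by simp)))
  rcases hC0 with hC0 | rfl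
  swap
  · have := hC
    rcases isEmpty_or_nonempty ι with h | ⟨⟨o⟩⟩
    · have : u = 0 := by ext o; exact h.elim o
      simp [this]
    · have := hC o ∅ (by simp)
      simp only [Finset.sum_empty] at this ⊢
      positivity
  have hsq : ∑ o ∈ t.image g, u o ^ 2 ≤ ‖u‖ ^ 2 := by
    have := lp.sum_rpow_le_norm_rpow (p := 2) (by norm_num) u (t.image g)
    simpa using this
  calc ∑ k ∈ t, (c k * u (g k)) ^ 2
      = ∑ o ∈ t.image g, ∑ k ∈ t with g k = o, (c k * u (g k)) ^ 2 :=
        (Finset.sum_fiberwise_of_maps_to (fun k hk => Finset.mem_image_of_mem g hk) _).symm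
    _ ≤ ∑ o ∈ t.image g, C * u o ^ 2 := by
        refine Finset.sum_le_sum fun o _ => ?_
        have : ∑ k ∈ t with g k = o, (c k * u (g k)) ^ 2 =
            (∑ k ∈ t with g k = o, c k ^ 2) * u o ^ 2 := by
          rw [Finset.sum_mul]
          refine Finset.sum_congr rfl fun k hk => ?_
          rw [(Finset.mem_filter.mp hk).2, mul_pow]
        rw [this]
        gcongr
        exact hC o _ fun k hk => (Finset.mem_filter.mp hk).2
    _ = C * ∑ o ∈ t.image g, u o ^ 2 := by rw [Finset.mul_sum]
    _ ≤ C * ‖u‖ ^ 2 := by gcongr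

/-- The bounded operator `(pull u)(k) = c(k) u(g(k))` between `ℓ²` spaces. -/
noncomputable def pull (g : κ → ι) (c : κ → ℝ) (C : ℝ)
    (hC : ∀ o (s : Finset κ), (∀ k ∈ s, g k = o) → ∑ k ∈ s, c k ^ 2 ≤ C) :
    lp (fun _ : ι => ℝ) 2 →L[ℝ] lp (fun _ : κ => ℝ) 2 :=
  LinearMap.mkContinuous
    { toFun := fun u => ⟨fun k => c k * u (g k), by
        refine memℓp_gen' (C := C * ‖u‖ ^ 2) fun s => ?_
        simpa [mul_pow] using sum_sq_pull_le g c hC u s⟩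
      map_add' := fun u w => by ext k; exact mul_add _ _ _
      map_smul' := fun a u => by ext k; exact mul_left_comm _ _ _ }
    (Real.sqrt C) (fun u => by
      refine lp.norm_le_of_forall_sum_le (by norm_num) (by positivity) fun s => ?_
      have h := sum_sq_pull_le g c hC u s
      have h2 : C * ‖u‖ ^ 2 ≤ (Real.sqrt C * ‖u‖) ^ 2 := by
        rw [mul_pow]
        gcongr
        rw [← Real.sqrt_le_sqrt_iff (by positivity), Real.sqrt_sq (by positivity)]
      simpa [mul_pow] using h.trans h2)

theorem pull_apply (g : κ → ι) (c : κ → ℝ) (C : ℝ)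
    (hC : ∀ o (s : Finset κ), (∀ k ∈ s, g k = o) → ∑ k ∈ s, c k ^ 2 ≤ C)
    (u : lp (fun _ : ι => ℝ) 2) (k : κ) : pull g c C hC u k = c k * u (g k) := rfl

theorem norm_sq_pull_le (g : κ → ι) (c : κ → ℝ) (C : ℝ)
    (hC : ∀ o (s : Finset κ), (∀ k ∈ s, g k = o) → ∑ k ∈ s, c k ^ 2 ≤ C)
    (u : lp (fun _ : ι => ℝ) 2) : ‖pull g c C hC u‖ ^ 2 ≤ C * ‖u‖ ^ 2 := by
  have h := lp.norm_rpow_eq_tsum (p := 2) (by norm_num) (pull g c C hC u)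
  have h1 : ‖pull g c C hC u‖ ^ 2 = ∑' k, (c k * u (g k)) ^ 2 := by simpa [pull_apply, mul_pow] using h
  rw [h1]
  refine Real.tsum_le_of_sum_le (fun k => sq_nonneg _) (sum_sq_pull_le g c hC u)

theorem fiber_bound_of_injective {g : κ → ι} (hg : Function.Injective g) {c : κ → ℝ} {C : ℝ}
    (hc : ∀ k, |c k| ≤ C) (o : ι) (s : Finset κ) (hs : ∀ k ∈ s, g k = o) :
    ∑ k ∈ s, c k ^ 2 ≤ C ^ 2 := by
  have h1 : s.card ≤ 1 := Finset.card_le_one.mpr fun a ha b hb => hg ((hs a ha).trans (hs b hb).symm)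
  calc ∑ k ∈ s, c k ^ 2 ≤ ∑ k ∈ s, C ^ 2 :=
        Finset.sum_le_sum fun k _ => sq_le_sq' (neg_le_of_abs_le (hc k)) (le_of_abs_le (hc k))
    _ = s.card * C ^ 2 := by rw [Finset.sum_const, nsmul_eq_mul]
    _ ≤ 1 * C ^ 2 := by gcongr; exact_mod_cast h1
    _ = C ^ 2 := one_mul _

/-- The weighted composition operator `(wcomp u)(k) = c(k) u(φ(k))` for a permutation `φ`. -/
noncomputable def wcomp (φ : κ ≃ κ) (c : κ → ℝ) (C : ℝ) (hc : ∀ k, |c k| ≤ C) :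
    lp (fun _ : κ => ℝ) 2 →L[ℝ] lp (fun _ : κ => ℝ) 2 :=
  pull φ c (C ^ 2) (fiber_bound_of_injective φ.injective hc)

theorem wcomp_apply (φ : κ ≃ κ) (c : κ → ℝ) (C : ℝ) (hc : ∀ k, |c k| ≤ C)
    (u : lp (fun _ : κ => ℝ) 2) (k : κ) : wcomp φ c C hc u k = c k * u (φ k) := rfl

theorem inner_eq_tsum_mul (u w : lp (fun _ : κ => ℝ) 2) : inner ℝ u w = ∑' k, u k * w k := by
  rw [lp.inner_eq_tsum]
  exact tsum_congr fun k => by simp [mul_comm]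

theorem norm_wcomp_le (φ : κ ≃ κ) (c : κ → ℝ) (C : ℝ) (hc : ∀ k, |c k| ≤ C) (hC : 0 ≤ C)
    (u : lp (fun _ : κ => ℝ) 2) : ‖wcomp φ c C hc u‖ ≤ C * ‖u‖ := by
  have := norm_sq_pull_le φ c (C ^ 2) (fiber_bound_of_injective φ.injective hc) u
  rw [← mul_pow] at this
  exact le_of_sq_le_sq this (by positivity)

/-- Two weighted permutations inverse to each other, with matching weights, are adjoint. -/
theorem inner_wcomp (φ ψ : κ ≃ κ) (hφ : ∀ k, φ (ψ k) = k) (c c' : κ → ℝ) (C C' a : ℝ)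
    (hc : ∀ k, |c k| ≤ C) (hc' : ∀ k, |c' k| ≤ C') (h : ∀ k, c (ψ k) = a * c' k)
    (u w : lp (fun _ : κ => ℝ) 2) :
    inner ℝ (wcomp φ c C hc u) w = a * inner ℝ u (wcomp ψ c' C' hc' w) := by
  rw [inner_eq_tsum_mul, inner_eq_tsum_mul, ← ψ.tsum_eq, ← tsum_mul_left]
  refine tsum_congr fun k => ?_
  rw [wcomp_apply, wcomp_apply, hφ, h]
  ring

end Pullback

namespace LatticeGas

noncomputable section

variable {d : ℕ} (M : LatticeGas d)

/-! ### Marked sets modulo translations -/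

/-- The translation of points by `z`. -/
def shift (z : Fin d → ℤ) : M.Pt ≃ M.Pt where
  toFun p := (p.1 + z, p.2)
  invFun p := (p.1 - z, p.2)
  left_inv p := by simp
  right_inv p := by simp

theorem shift_apply (z : Fin d → ℤ) (p : M.Pt) : M.shift z p = (p.1 + z, p.2) := rfl

theorem translate_eq_map (z : Fin d → ℤ) (A : Finset M.Pt) :
    M.translate z A = A.map (M.shift z).toEmbedding := rfl

theorem shift_shift (z w : Fin d → ℤ) (p : M.Pt) :
    M.shift z (M.shift w p) = M.shift (w + z) p := by
  simp [shift_apply, add_assoc]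

theorem shift_comm (z w : Fin d → ℤ) (p : M.Pt) :
    M.shift z (M.shift w p) = M.shift w (M.shift z p) := by
  rw [shift_shift, shift_shift, add_comm]

theorem shift_zero (p : M.Pt) : M.shift 0 p = p := by simp [shift_apply]

theorem shift_neg (e : Fin d → ℤ) (p : M.Pt) : M.shift (-e) (M.shift e p) = p := by
  rw [shift_shift, add_neg_cancel, shift_zero]

theorem shift_ne {e : Fin d → ℤ} (he : e ≠ 0) (p : M.Pt) : M.shift e p ≠ p := by
  intro h
  exact he (by simpa [shift_apply] using congrArg Prod.fst h)

/-- Translations act freely on non-empty finite sets. -/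
theorem eq_zero_of_translate_eq {A : Finset M.Pt} (hA : A.Nonempty) {z : Fin d → ℤ}
    (h : M.translate z A = A) : z = 0 := by
  -- A translation by z moves the sum of the positions by |A| z.
  have h1 : ∑ p ∈ M.translate z A, p.1 = ∑ p ∈ A, p.1 + A.card • z := by
    rw [translate_eq_map, Finset.sum_map]
    simp [shift_apply, Finset.sum_add_distrib]
  rw [h] at h1
  have h2 : A.card • z = 0 := by simpa using h1
  rcases smul_eq_zero.mp h2 with h3 | h3
  · exact absurd h3 hA.card_pos.ne'
  · exact h3

theorem translate_injective_left {A : Finset M.Pt} (hA : A.Nonempty) {z w : Fin d → ℤ}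
    (h : M.translate z A = M.translate w A) : z = w := by
  have h1 := congrArg (M.translate (-w)) h
  rw [translate_translate, translate_translate, add_neg_cancel, translate_zero] at h1
  simpa [add_neg_eq_zero] using M.eq_zero_of_translate_eq hA h1

/-- Finite sets with a marked element. -/
abbrev PreMarked : Type := {a : Finset M.Pt × M.Pt // a.2 ∈ a.1}

theorem shift_mem {z : Fin d → ℤ} {A : Finset M.Pt} {p : M.Pt} :
    M.shift z p ∈ M.translate z A ↔ p ∈ A :=
  Finset.mem_map' _

instance markedSetoid : Setoid M.PreMarked where
  r a b := ∃ z, a.1.1 = M.translate z b.1.1 ∧ a.1.2 = M.shift z b.1.2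
  iseqv :=
    { refl := fun a => ⟨0, (M.translate_zero _).symm, (M.shift_zero _).symm⟩
      symm := by
        rintro a b ⟨z, h, h'⟩
        refine ⟨-z, ?_, ?_⟩
        · rw [h, translate_translate, add_neg_cancel, translate_zero]
        · rw [h', shift_neg]
      trans := by
        rintro a b c ⟨z, h, h'⟩ ⟨w, k, k'⟩
        refine ⟨w + z, ?_, ?_⟩
        · rw [h, k, translate_translate]
        · rw [h', k', shift_shift] }

/-- Finite sets with a marked element, modulo translations. -/
abbrev Marked : Type := Quotient M.markedSetoid

/-- The class of the set `A` with the marked element `p`. -/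
def mark (A : Finset M.Pt) (p : M.Pt) (hp : p ∈ A) : M.Marked := ⟦⟨(A, p), hp⟩⟧

/-- The class of a non-empty set. -/
def orb (A : Finset M.Pt) (hA : A.Nonempty) : M.Orbit := ⟦⟨A, hA⟩⟧

theorem deg_orb (A : Finset M.Pt) (hA : A.Nonempty) : M.deg (M.orb A hA) = A.card := rfl

theorem orb_eq_orb {A B : Finset M.Pt} {hA : A.Nonempty} {hB : B.Nonempty} :
    M.orb A hA = M.orb B hB ↔ ∃ z, A = M.translate z B := Quotient.eq

theorem exists_orb (o : M.Orbit) : ∃ A hA, M.orb A hA = o := by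
  induction o using Quotient.inductionOn with
  | _ A => exact ⟨A.1, A.2, rfl⟩

theorem exists_mark (k : M.Marked) : ∃ A p hp, M.mark A p hp = k := by
  induction k using Quotient.inductionOn with
  | _ a => exact ⟨a.1.1, a.1.2, a.2, rfl⟩

/-- Forget the mark. -/
def unmark : M.Marked → M.Orbit :=
  Quotient.map (fun a => ⟨a.1.1, ⟨_, a.2⟩⟩) (by
    rintro a b ⟨z, h, -⟩
    exact ⟨z, h⟩)

theorem unmark_mark (A : Finset M.Pt) (p : M.Pt) (hp : p ∈ A) :
    M.unmark (M.mark A p hp) = M.orb A ⟨p, hp⟩ := rfl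

/-- Translations act freely, so the points of a set give pairwise different marks; sums over the
marks of an orbit are sums over the points of a representative, without multiplicities. -/
theorem mark_injective {A : Finset M.Pt} {p q : M.Pt} {hp : p ∈ A} {hq : q ∈ A}
    (h : M.mark A p hp = M.mark A q hq) : p = q := by
  obtain ⟨z, h1, h2⟩ := Quotient.exact h
  have : z = 0 := M.eq_zero_of_translate_eq ⟨p, hp⟩ h1.symm
  subst this
  rwa [shift_zero] at h2

theorem exists_mark_of_unmark_eq {A : Finset M.Pt} {hA : A.Nonempty} {k : M.Marked}
    (h : M.unmark k = M.orb A hA) : ∃ p hp, M.mark A p hp = k := by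
  obtain ⟨B, q, hq, rfl⟩ := M.exists_mark k
  obtain ⟨z, hz⟩ := (M.orb_eq_orb (hA := ⟨q, hq⟩)).mp h
  have hA' : A = M.translate (-z) B := by
    rw [hz, translate_translate, add_neg_cancel, translate_zero]
  refine ⟨M.shift (-z) q, ?_, ?_⟩
  · rw [hA', shift_mem]
    exact hq
  · exact Quotient.sound ⟨-z, hA', rfl⟩

/-- The number of points of a marked set. -/
def size (k : M.Marked) : ℕ := M.deg (M.unmark k)

theorem size_mark (A : Finset M.Pt) (p : M.Pt) (hp : p ∈ A) : M.size (M.mark A p hp) = A.card := rfl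

/-- There are at most `deg o` ways to mark the orbit `o`. -/
theorem card_fiber_le (o : M.Orbit) (s : Finset M.Marked) (hs : ∀ k ∈ s, M.unmark k = o) :
    s.card ≤ M.deg o := by
  classical
  obtain ⟨A, hA, rfl⟩ := M.exists_orb o
  have : s ⊆ A.attach.image fun p => M.mark A p.1 p.2 := by
    intro k hk
    obtain ⟨p, hp, rfl⟩ := M.exists_mark_of_unmark_eq (hs k hk)
    exact Finset.mem_image.mpr ⟨⟨p, hp⟩, Finset.mem_attach _ _, rfl⟩
  refine (Finset.card_le_card this).trans (Finset.card_image_le.trans ?_)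
  rw [Finset.card_attach, deg_orb]

/-- Summation over the marked sets above the orbit of `A`. -/
theorem tsum_fiber (A : Finset M.Pt) (hA : A.Nonempty) (F : M.Marked → ℝ)
    (hF : ∀ k, M.unmark k ≠ M.orb A hA → F k = 0) :
    ∑' k, F k = ∑ p ∈ A.attach, F (M.mark A p.1 p.2) := by
  classical
  rw [tsum_eq_sum (s := A.attach.image fun p => M.mark A p.1 p.2), Finset.sum_image]
  · rintro p - q - h
    exact Subtype.ext (M.mark_injective h)
  · intro k hk
    refine hF k fun h => hk ?_
    obtain ⟨p, hp, rfl⟩ := M.exists_mark_of_unmark_eq h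
    exact Finset.mem_image.mpr ⟨⟨p, hp⟩, Finset.mem_attach _ _, rfl⟩

/-- The velocity of the marked point. -/
def vel : M.Marked → M.Vel :=
  Quotient.lift (fun a => a.1.2.2) (by
    rintro a b ⟨z, -, h⟩
    simp [h, shift_apply])

theorem vel_mark (A : Finset M.Pt) (p : M.Pt) (hp : p ∈ A) : M.vel (M.mark A p hp) = p.2 := rfl

/-- The marked point is the only point of the set at its site. -/
def Lone : M.Marked → Prop :=
  Quotient.lift (fun a => ∀ q ∈ a.1.1, q.1 = a.1.2.1 → q = a.1.2) (by
    rintro a b ⟨z, h, h'⟩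
    simp only [h, h', translate_eq_map, Finset.forall_mem_map, Equiv.coe_toEmbedding, eq_iff_iff]
    refine forall₂_congr fun q _ => ?_
    rw [(M.shift z).apply_eq_iff_eq]
    simp [shift_apply])

theorem lone_mark (A : Finset M.Pt) (p : M.Pt) (hp : p ∈ A) :
    M.Lone (M.mark A p hp) ↔ ∀ q ∈ A, q.1 = p.1 → q = p := Iff.rfl

/-! ### Moves of marked sets -/

theorem swap_swap_apply {α : Type*} [DecidableEq α] (p q r : α) :
    Equiv.swap p q (Equiv.swap p q r) = r := by
  simp

/-- The set `A` after the exchange of the points `p` and `q`. -/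
def swapSet (A : Finset M.Pt) (p q : M.Pt) : Finset M.Pt := A.map (Equiv.swap p q).toEmbedding

theorem mem_swapSet {A : Finset M.Pt} {p q r : M.Pt} :
    r ∈ M.swapSet A p q ↔ Equiv.swap p q r ∈ A := by
  rw [swapSet, Finset.mem_map_equiv, Equiv.symm_swap]

theorem card_swapSet (A : Finset M.Pt) (p q : M.Pt) : (M.swapSet A p q).card = A.card :=
  Finset.card_map _

theorem swapSet_swapSet (A : Finset M.Pt) (p q : M.Pt) : M.swapSet (M.swapSet A p q) q p = A := by
  ext r
  rw [mem_swapSet, mem_swapSet, Equiv.swap_comm q p, swap_swap_apply]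

theorem swapSet_of_mem {A : Finset M.Pt} {p q : M.Pt} (hp : p ∈ A) (hq : q ∈ A) :
    M.swapSet A p q = A := by
  ext r
  rw [mem_swapSet, Equiv.swap_apply_def]
  split_ifs with h1 h2 <;> simp_all

theorem swap_shift (z : Fin d → ℤ) (p q r : M.Pt) :
    Equiv.swap (M.shift z p) (M.shift z q) (M.shift z r) = M.shift z (Equiv.swap p q r) :=
  ((M.shift z).injective.map_swap p q r).symm

theorem swapSet_translate (z : Fin d → ℤ) (A : Finset M.Pt) (p q : M.Pt) :
    M.swapSet (M.translate z A) (M.shift z p) (M.shift z q) = M.translate z (M.swapSet A p q) := by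
  ext r
  obtain ⟨r, rfl⟩ := (M.shift z).surjective r
  rw [mem_swapSet, swap_shift, shift_mem, shift_mem, mem_swapSet]

/-- The set `A` after `q` has been added, or, if `q` is in `A` already, after `p` has been
removed. -/
def toggleSet (A : Finset M.Pt) (p q : M.Pt) : Finset M.Pt :=
  -- With `A.erase p` in place of `A` in the test, the case q = p leaves the set unchanged, so that
  -- `toggle e` is a permutation for e = 0 too.
  by classical exact if q ∈ A.erase p then A.erase p else insert q A

theorem mem_toggleSet_right {A : Finset M.Pt} {p q : M.Pt} : q ∈ M.toggleSet A p q := by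
  rw [toggleSet]
  split_ifs with h
  · exact h
  · exact Finset.mem_insert_self _ _

theorem toggleSet_toggleSet {A : Finset M.Pt} {p q : M.Pt} (hp : p ∈ A) :
    M.toggleSet (M.toggleSet A p q) q p = A := by
  classical
  rw [toggleSet, toggleSet]
  rcases eq_or_ne q p with rfl | hqp
  · simp [hp]
  · by_cases hq : q ∈ A
    · have h1 : q ∈ A.erase p := Finset.mem_erase.mpr ⟨hqp, hq⟩
      simp [h1, Finset.insert_erase hp]
    · have h1 : q ∉ A.erase p := fun h => hq (Finset.mem_of_mem_erase h)
      simp [h1, hq, hp]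

theorem toggleSet_translate (z : Fin d → ℤ) (A : Finset M.Pt) (p q : M.Pt) :
    M.toggleSet (M.translate z A) (M.shift z p) (M.shift z q) =
      M.translate z (M.toggleSet A p q) := by
  classical
  have h1 : (M.translate z A).erase (M.shift z p) = M.translate z (A.erase p) :=
    (Finset.map_erase _ _ _).symm
  simp only [toggleSet, h1, shift_mem]
  split_ifs
  · rfl
  · exact (Finset.map_insert _ _ _).symm

theorem card_toggleSet {A : Finset M.Pt} {p q : M.Pt} (hp : p ∈ A) (hpq : q ≠ p) :
    (M.toggleSet A p q).card = A.card + 1 ∨ (M.toggleSet A p q).card + 1 = A.card := by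
  classical
  rw [toggleSet]
  split_ifs with h
  · exact Or.inr (Finset.card_erase_add_one hp)
  · refine Or.inl (Finset.card_insert_of_notMem fun hq => h ?_)
    exact Finset.mem_erase.mpr ⟨hpq, hq⟩

/-- The marked point moves by `e`. -/
def hopFun (e : Fin d → ℤ) : M.Marked → M.Marked :=
  Quotient.map (fun a => ⟨(M.swapSet a.1.1 a.1.2 (M.shift e a.1.2), M.shift e a.1.2), by
    rw [mem_swapSet, Equiv.swap_apply_right]; exact a.2⟩) (by
    rintro a b ⟨z, h, h'⟩
    refine ⟨z, ?_, ?_⟩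
    · simp only [h, h']
      rw [shift_comm, swapSet_translate]
    · simp only [h']
      rw [shift_comm])

/-- The move of the marked point by `e`, exchanging occupation numbers. -/
def hop (e : Fin d → ℤ) : M.Marked ≃ M.Marked :=
  have h : ∀ e k, M.hopFun (-e) (M.hopFun e k) = k := fun e k => by
    induction k using Quotient.inductionOn with
    | _ a =>
      refine congrArg (Quotient.mk M.markedSetoid) (Subtype.ext (Prod.ext ?_ ?_))
      · simp only [shift_neg, swapSet_swapSet]
      · simp only [shift_neg]
  { toFun := M.hopFun e
    invFun := M.hopFun (-e)
    left_inv := h e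
    right_inv := fun k => by simpa using h (-e) k }

theorem hop_hop (e : Fin d → ℤ) (k : M.Marked) : M.hop e (M.hop (-e) k) = k :=
  (M.hop e).apply_symm_apply k

theorem hop_mark (e : Fin d → ℤ) (A : Finset M.Pt) (p : M.Pt) (hp : p ∈ A) :
    ∃ h, M.hop e (M.mark A p hp) = M.mark (M.swapSet A p (M.shift e p)) (M.shift e p) h := ⟨_, rfl⟩

/-- The marked point creates its neighbour at `e` or is absorbed by it, and the mark moves to the
neighbour. -/
def toggleFun (e : Fin d → ℤ) : M.Marked → M.Marked :=
  Quotient.map (fun a => ⟨(M.toggleSet a.1.1 a.1.2 (M.shift e a.1.2), M.shift e a.1.2),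
    M.mem_toggleSet_right⟩) (by
    rintro a b ⟨z, h, h'⟩
    refine ⟨z, ?_, ?_⟩
    · simp only [h, h']
      rw [shift_comm, toggleSet_translate]
    · simp only [h']
      rw [shift_comm])

/-- The permutation of the marked sets given by `toggleFun`. -/
def toggle (e : Fin d → ℤ) : M.Marked ≃ M.Marked :=
  have h : ∀ e k, M.toggleFun (-e) (M.toggleFun e k) = k := fun e k => by
    induction k using Quotient.inductionOn with
    | _ a =>
      refine congrArg (Quotient.mk M.markedSetoid) (Subtype.ext (Prod.ext ?_ ?_))
      · simp only [shift_neg, M.toggleSet_toggleSet a.2]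
      · simp only [shift_neg]
  { toFun := M.toggleFun e
    invFun := M.toggleFun (-e)
    left_inv := h e
    right_inv := fun k => by simpa using h (-e) k }

theorem toggle_toggle (e : Fin d → ℤ) (k : M.Marked) : M.toggle e (M.toggle (-e) k) = k :=
  (M.toggle e).apply_symm_apply k

theorem toggle_mark (e : Fin d → ℤ) (A : Finset M.Pt) (p : M.Pt) (hp : p ∈ A) :
    ∃ h, M.toggle e (M.mark A p hp) = M.mark (M.toggleSet A p (M.shift e p)) (M.shift e p) h :=
  ⟨_, rfl⟩

/-- At the site of the marked point, the velocities `u` and `w` are exchanged. -/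
def relabelFun (u w : M.Vel) : M.Marked → M.Marked :=
  Quotient.map (fun a => ⟨(M.swapSet a.1.1 (a.1.2.1, u) (a.1.2.1, w),
      Equiv.swap (a.1.2.1, u) (a.1.2.1, w) a.1.2), by
    simp only [mem_swapSet, swap_swap_apply]; exact a.2⟩) (by
    rintro a b ⟨z, h, h'⟩
    refine ⟨z, ?_, ?_⟩
    · simp only [h, h']
      exact M.swapSet_translate z _ (_, u) (_, w)
    · simp only [h']
      exact M.swap_shift z (_, u) (_, w) _)

theorem swap_fst (x : Fin d → ℤ) (u w : M.Vel) (p : M.Pt) :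
    (Equiv.swap (x, u) (x, w) p).1 = p.1 := by
  rw [Equiv.swap_apply_def]
  split_ifs with h1 h2 <;> simp_all

theorem relabelFun_relabelFun (u w : M.Vel) (k : M.Marked) :
    M.relabelFun w u (M.relabelFun u w k) = k := by
  induction k using Quotient.inductionOn with
  | _ a =>
    refine congrArg (Quotient.mk M.markedSetoid) (Subtype.ext (Prod.ext ?_ ?_))
    · simp only [swap_fst, swapSet_swapSet]
    · simp only [swap_fst]
      rw [Equiv.swap_comm, swap_swap_apply]

/-- The permutation of the marked sets given by `relabelFun`. -/
def relabel (u w : M.Vel) : M.Marked ≃ M.Marked where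
  toFun := M.relabelFun u w
  invFun := M.relabelFun w u
  left_inv := M.relabelFun_relabelFun u w
  right_inv := M.relabelFun_relabelFun w u

theorem relabel_relabel (u w : M.Vel) (k : M.Marked) : M.relabel u w (M.relabel w u k) = k :=
  (M.relabel u w).apply_symm_apply k

theorem relabel_mark (u w : M.Vel) (A : Finset M.Pt) (p : M.Pt) (hp : p ∈ A) :
    ∃ h, M.relabel u w (M.mark A p hp) =
      M.mark (M.swapSet A (p.1, u) (p.1, w)) (Equiv.swap (p.1, u) (p.1, w) p) h := ⟨_, rfl⟩

theorem size_hop (e : Fin d → ℤ) (k : M.Marked) : M.size (M.hop e k) = M.size k := by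
  obtain ⟨A, p, hp, rfl⟩ := M.exists_mark k
  obtain ⟨h, h'⟩ := M.hop_mark e A p hp
  rw [h', size_mark, size_mark, card_swapSet]

theorem size_relabel (u w : M.Vel) (k : M.Marked) : M.size (M.relabel u w k) = M.size k := by
  obtain ⟨A, p, hp, rfl⟩ := M.exists_mark k
  obtain ⟨h, h'⟩ := M.relabel_mark u w A p hp
  rw [h', size_mark, size_mark, card_swapSet]

theorem size_toggle {e : Fin d → ℤ} (he : e ≠ 0) (k : M.Marked) :
    M.size (M.toggle e k) = M.size k + 1 ∨ M.size (M.toggle e k) + 1 = M.size k := by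
  obtain ⟨A, p, hp, rfl⟩ := M.exists_mark k
  obtain ⟨h, h'⟩ := M.toggle_mark e A p hp
  rw [h', size_mark, size_mark]
  exact M.card_toggleSet hp (M.shift_ne he p)

theorem vel_toggle (e : Fin d → ℤ) (k : M.Marked) : M.vel (M.toggle e k) = M.vel k := by
  obtain ⟨A, p, hp, rfl⟩ := M.exists_mark k
  rfl

theorem vel_relabel (u w : M.Vel) {k : M.Marked} (hk : M.vel k = u) :
    M.vel (M.relabel u w k) = w := by
  obtain ⟨A, p, hp, rfl⟩ := M.exists_mark k
  obtain ⟨h, h'⟩ := M.relabel_mark u w A p hp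
  rw [vel_mark] at hk
  rw [h', vel_mark, ← hk, Equiv.swap_apply_left]

theorem lone_relabel (u w : M.Vel) {k : M.Marked} (hk : M.Lone k) : M.Lone (M.relabel u w k) := by
  obtain ⟨A, p, hp, rfl⟩ := M.exists_mark k
  obtain ⟨h, h'⟩ := M.relabel_mark u w A p hp
  rw [h', lone_mark]
  intro q hq hq'
  rw [mem_swapSet] at hq
  rw [swap_fst] at hq'
  have h1 : Equiv.swap (p.1, u) (p.1, w) q = p := hk _ hq (by rw [swap_fst, hq'])
  have h2 := congrArg (Equiv.swap (p.1, u) (p.1, w)) h1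
  rwa [swap_swap_apply] at h2

/-- Transpositions do not compose to a transposition in general. At a lone mark, however, the marked
point is the only one that moves, and its velocity goes from u to w to w'. -/
theorem relabel_trans (u w w' : M.Vel) {k : M.Marked} (hk : M.Lone k) (hu : M.vel k = u) :
    M.relabel w w' (M.relabel u w k) = M.relabel u w' k := by
  obtain ⟨A, p, hp, rfl⟩ := M.exists_mark k
  obtain ⟨x, v⟩ := p
  obtain rfl : v = u := hu
  refine congrArg (Quotient.mk M.markedSetoid) (Subtype.ext (Prod.ext ?_ ?_))
  · classical
    simp only [swap_fst, swapSet]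
    rw [Finset.map_map]
    simp only [Finset.map_eq_image]
    refine Finset.image_congr fun q hq => ?_
    simp only [Function.Embedding.trans_apply, Equiv.coe_toEmbedding]
    by_cases h : q.1 = x
    · rw [hk q hq h, Equiv.swap_apply_left, Equiv.swap_apply_left, Equiv.swap_apply_left]
    · have hne : ∀ c : M.Vel, q ≠ (x, c) := fun c hc => h (by rw [hc])
      rw [Equiv.swap_apply_of_ne_of_ne (hne _) (hne _), Equiv.swap_apply_of_ne_of_ne (hne _) (hne _),
        Equiv.swap_apply_of_ne_of_ne (hne _) (hne _)]
  · simp only [Equiv.swap_apply_left]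

end

end LatticeGas

namespace LatticeGas

noncomputable section

variable {d : ℕ} (M : LatticeGas d)

open ContinuousLinearMap (adjoint adjoint_inner_left adjoint_inner_right)

/-! ### The parts of the generator on marked sets -/

/-- Square summable functions of marked sets. -/
abbrev MarkedL2 : Type := lp (fun _ : M.Marked => ℝ) 2

theorem inner_congr {κ : Type*} {a b c e : lp (fun _ : κ => ℝ) 2} (h : ∀ k, a k * b k = c k * e k) :
    inner ℝ a b = inner ℝ c e := by
  rw [inner_eq_tsum_mul, inner_eq_tsum_mul]
  exact tsum_congr h

/-- Both rates γ ± v_j / 2 are non-negative; this bounds the weights in `toggleOp`. -/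
theorem abs_vel_le (v : M.Vel) (j : Fin d) : |(v : Fin d → ℝ) j| ≤ 2 * M.γ := by
  have := M.rate_nonneg v v.2 j
  rw [abs_le]
  constructor <;> linarith [this.1, this.2]

/-- One direction of the degree changing part. -/
def toggleOp (j : Fin d) (s : ℤ) : M.MarkedL2 →L[ℝ] M.MarkedL2 :=
  wcomp (M.toggle (Pi.single j s)) (fun k => 1 / 2 * s * (M.vel k : Fin d → ℝ) j) (|(s : ℝ)| * M.γ)
    (fun k => by
      rw [abs_mul, abs_mul, abs_of_pos (by norm_num : (0 : ℝ) < 1 / 2)]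
      have := M.abs_vel_le (M.vel k) j
      calc 1 / 2 * |(s : ℝ)| * |(M.vel k : Fin d → ℝ) j| ≤ 1 / 2 * |(s : ℝ)| * (2 * M.γ) := by gcongr
        _ = |(s : ℝ)| * M.γ := by ring)

/-- The inverse of a toggle is the toggle in the opposite direction. It keeps the velocity of the
mark, and the weight is odd in `s`, which produces the sign. -/
theorem inner_toggleOp (j : Fin d) (s : ℤ) (g h : M.MarkedL2) :
    inner ℝ (M.toggleOp j s g) h = -inner ℝ g (M.toggleOp j (-s) h) := by
  rw [neg_eq_neg_one_mul]
  refine inner_wcomp _ _ (fun k => ?_) _ _ _ _ _ _ _ (fun k => ?_) g h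
  · rw [Pi.single_neg, toggle_toggle]
  · rw [vel_toggle]
    push_cast
    ring

/-- The degree changing part of the generator on functions of marked sets. -/
def skewOp : M.MarkedL2 →L[ℝ] M.MarkedL2 :=
  ∑ j : Fin d, ∑ s ∈ ({1, -1} : Finset ℤ), M.toggleOp j s

theorem skewOp_apply (h : M.MarkedL2) (k : M.Marked) :
    M.skewOp h k = ∑ j : Fin d, ∑ s ∈ ({1, -1} : Finset ℤ),
      1 / 2 * s * (M.vel k : Fin d → ℝ) j * h (M.toggle (Pi.single j s) k) := by
  simp only [skewOp, sum_apply, lp.coeFn_sum, Finset.sum_apply]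
  rfl

theorem inner_skewOp (g h : M.MarkedL2) :
    inner ℝ (M.skewOp g) h = -inner ℝ g (M.skewOp h) := by
  simp only [skewOp, sum_apply, sum_inner, inner_sum, ← Finset.sum_neg_distrib]
  refine Finset.sum_congr rfl fun j _ => ?_
  rw [Finset.sum_pair (by norm_num), Finset.sum_pair (by norm_num), inner_toggleOp, inner_toggleOp,
    neg_neg, add_comm]

/-- The hop of the marked point as an operator. -/
def hopOp (j : Fin d) (s : ℤ) : M.MarkedL2 →L[ℝ] M.MarkedL2 :=
  wcomp (M.hop (Pi.single j s)) (fun _ => 1) 1 (fun _ => by simp)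

/-- If the target is occupied, the set stays and only the mark moves. This convention makes the hop
a permutation, inverse to the hop in the opposite direction. -/
theorem inner_hopOp (j : Fin d) (s : ℤ) (g h : M.MarkedL2) :
    inner ℝ (M.hopOp j s g) h = inner ℝ g (M.hopOp j (-s) h) := by
  rw [← one_mul (inner ℝ g _)]
  refine inner_wcomp _ _ (fun k => ?_) _ _ _ _ _ _ _ (fun k => ?_) g h
  · rw [Pi.single_neg, hop_hop]
  · rw [one_mul]

/-- The coefficients of `φ_{x,q}`. -/
def phiCoeff (q : M.Vel × M.Vel × M.Vel × M.Vel) (u : M.Vel) : ℝ :=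
  (if q.2.2.1 = u then 1 else 0) + (if q.2.2.2 = u then 1 else 0) - (if q.1 = u then 1 else 0) -
    (if q.2.1 = u then 1 else 0)

/-- Four times the squared norm of `φ_{x,q}`. -/
def phiNormSq (q : M.Vel × M.Vel × M.Vel × M.Vel) : ℝ := ∑ u, M.phiCoeff q u ^ 2

open Classical in
/-- The matrix units of the collision operator. -/
def unitOp (u w : M.Vel) : M.MarkedL2 →L[ℝ] M.MarkedL2 :=
  wcomp (M.relabel u w) (fun k => if M.Lone k ∧ M.vel k = u then 1 else 0) 1
    (fun k => by split_ifs <;> simp)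

open Classical in
theorem unitOp_apply (u w : M.Vel) (h : M.MarkedL2) (k : M.Marked) :
    M.unitOp u w h k = (if M.Lone k ∧ M.vel k = u then 1 else 0) * h (M.relabel u w k) := rfl

theorem lone_and_vel_relabel (u w : M.Vel) (k : M.Marked) :
    (M.Lone (M.relabel u w k) ∧ M.vel (M.relabel u w k) = w) ↔ (M.Lone k ∧ M.vel k = u) := by
  constructor
  · rintro ⟨h1, h2⟩
    have h3 := M.lone_relabel w u h1
    have h4 := M.vel_relabel w u h2
    rw [relabel_relabel] at h3 h4
    exact ⟨h3, h4⟩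
  · rintro ⟨h1, h2⟩
    exact ⟨M.lone_relabel u w h1, M.vel_relabel u w h2⟩

theorem inner_unitOp (u w : M.Vel) (g h : M.MarkedL2) :
    inner ℝ (M.unitOp u w g) h = inner ℝ g (M.unitOp w u h) := by
  rw [← one_mul (inner ℝ g _)]
  refine inner_wcomp _ _ (fun k => M.relabel_relabel u w k) _ _ _ _ _ _ _ (fun k => ?_) g h
  rw [one_mul]
  congr 1
  exact propext (M.lone_and_vel_relabel w u k)

/-- Together with `inner_unitOp` this is the calculus of matrix units E_{uw} E_{ww'} = E_{uw'},
E_{uw}* = E_{wu}, valid because `unitOp` is restricted to lone marks. -/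
theorem unitOp_unitOp (u w w' : M.Vel) (h : M.MarkedL2) :
    M.unitOp u w (M.unitOp w w' h) = M.unitOp u w' h := by
  classical
  ext k
  rw [unitOp_apply, unitOp_apply, unitOp_apply]
  simp only [M.lone_and_vel_relabel]
  split_ifs with hk
  · rw [one_mul, one_mul, one_mul, M.relabel_trans u w w' hk.1 hk.2]
  · simp

/-- The collision operator on functions of marked sets, with the opposite sign. -/
def collOp : M.MarkedL2 →L[ℝ] M.MarkedL2 :=
  ∑ q ∈ M.Q, ∑ u, ∑ w, (M.phiCoeff q u * M.phiCoeff q w / M.phiNormSq q) • M.unitOp u w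

theorem inner_collOp (g h : M.MarkedL2) : inner ℝ (M.collOp g) h = inner ℝ g (M.collOp h) := by
  simp only [collOp, sum_apply, sum_inner, inner_sum,
    smul_apply, inner_smul_left, inner_smul_right, RCLike.conj_to_real]
  refine Finset.sum_congr rfl fun q _ => ?_
  rw [Finset.sum_comm]
  refine Finset.sum_congr rfl fun u _ => Finset.sum_congr rfl fun w _ => ?_
  rw [inner_unitOp]
  ring

theorem inner_collOp_nonneg (h : M.MarkedL2) : 0 ≤ inner ℝ h (M.collOp h) := by
  simp only [collOp, sum_apply, inner_sum,
    smul_apply, inner_smul_right]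
  refine Finset.sum_nonneg fun q _ => ?_
  -- For any fixed c one has E_{uw} = E_{cu}* E_{cw}; with c = `q.1` each collision contributes a
  -- multiple of a square.
  have h1 : ∑ u, ∑ w, M.phiCoeff q u * M.phiCoeff q w / M.phiNormSq q *
      inner ℝ h (M.unitOp u w h) = (M.phiNormSq q)⁻¹ *
      inner ℝ (∑ u, M.phiCoeff q u • M.unitOp q.1 u h) (∑ u, M.phiCoeff q u • M.unitOp q.1 u h) := by
    simp only [sum_inner, inner_sum, inner_smul_left, inner_smul_right, RCLike.conj_to_real,
      Finset.mul_sum]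
    rw [Finset.sum_comm]
    refine Finset.sum_congr rfl fun u _ => Finset.sum_congr rfl fun w _ => ?_
    rw [inner_unitOp, unitOp_unitOp]
    ring
  rw [h1]
  exact mul_nonneg (inv_nonneg.mpr (Finset.sum_nonneg fun u _ => sq_nonneg _)) real_inner_self_nonneg

/-- The degree preserving part of the generator on functions of marked sets. -/
def symOp : M.MarkedL2 →L[ℝ] M.MarkedL2 :=
  M.γ • (∑ j : Fin d, ∑ s ∈ ({1, -1} : Finset ℤ), (M.hopOp j s - ContinuousLinearMap.id ℝ _)) -
    M.collOp

theorem inner_symOp (g h : M.MarkedL2) : inner ℝ (M.symOp g) h = inner ℝ g (M.symOp h) := by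
  simp only [symOp, sub_apply, smul_apply,
    sum_apply, inner_sub_left, inner_sub_right, inner_smul_left,
    inner_smul_right, sum_inner, inner_sum, inner_collOp, ContinuousLinearMap.id_apply,
    RCLike.conj_to_real]
  congr 2
  refine Finset.sum_congr rfl fun j _ => ?_
  rw [Finset.sum_pair (by norm_num), Finset.sum_pair (by norm_num), inner_hopOp, inner_hopOp,
    neg_neg, add_comm]

theorem inner_symOp_nonpos (h : M.MarkedL2) : inner ℝ h (M.symOp h) ≤ 0 := by
  simp only [symOp, sub_apply, smul_apply,
    sum_apply, inner_sub_right, inner_smul_right, inner_sum,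
    ContinuousLinearMap.id_apply]
  have h1 := M.inner_collOp_nonneg h
  have h2 : M.γ * ∑ j : Fin d, ∑ s ∈ ({1, -1} : Finset ℤ),
      (inner ℝ h (M.hopOp j s h) - inner ℝ h h) ≤ 0 := by
    refine mul_nonpos_of_nonneg_of_nonpos M.γ_pos.le
      (Finset.sum_nonpos fun j _ => Finset.sum_nonpos fun s _ => ?_)
    have h3 := real_inner_le_norm h (M.hopOp j s h)
    have h4 : ‖M.hopOp j s h‖ ≤ 1 * ‖h‖ := norm_wcomp_le _ _ _ _ zero_le_one h
    rw [real_inner_self_eq_norm_mul_norm]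
    nlinarith [norm_nonneg h]
  linarith

open Classical in
theorem symOp_apply (h : M.MarkedL2) (k : M.Marked) :
    M.symOp h k = M.γ * (∑ j : Fin d, ∑ s ∈ ({1, -1} : Finset ℤ),
      (h (M.hop (Pi.single j s) k) - h k)) -
      ∑ q ∈ M.Q, ∑ u, ∑ w, M.phiCoeff q u * M.phiCoeff q w / M.phiNormSq q *
        ((if M.Lone k ∧ M.vel k = u then 1 else 0) * h (M.relabel u w k)) := by
  simp only [symOp, collOp, sub_apply, smul_apply,
    sum_apply, lp.coeFn_sum, lp.coeFn_sub, lp.coeFn_smul, Pi.sub_apply,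
    Pi.smul_apply, Finset.sum_apply, smul_eq_mul, ContinuousLinearMap.id_apply, unitOp_apply, hopOp,
    wcomp_apply, one_mul]

/-- The operator `symOp` only relates marked sets of the same size. -/
theorem symOp_congr {h h' : M.MarkedL2} {k : M.Marked}
    (hk : ∀ k', M.size k' = M.size k → h k' = h' k') : M.symOp h k = M.symOp h' k := by
  rw [symOp_apply, symOp_apply]
  simp only [hk _ (M.size_hop _ k), hk _ (M.size_relabel _ _ k), hk k rfl]

theorem single_ne_zero (j : Fin d) {s : ℤ} (hs : s ∈ ({1, -1} : Finset ℤ)) :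
    (Pi.single j s : Fin d → ℤ) ≠ 0 := by
  have : s ≠ 0 := by
    rintro rfl
    simp at hs
  simpa using this

/-- The operator `skewOp` only relates marked sets with sizes that differ by one. -/
theorem skewOp_congr {h h' : M.MarkedL2} {k : M.Marked}
    (hk : ∀ k', M.size k' = M.size k + 1 ∨ M.size k' + 1 = M.size k → h k' = h' k') :
    M.skewOp h k = M.skewOp h' k := by
  rw [skewOp_apply, skewOp_apply]
  refine Finset.sum_congr rfl fun j _ => Finset.sum_congr rfl fun s hs => ?_
  rw [hk _ (M.size_toggle (single_ne_zero j hs) k)]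

/-! ### Lifting from orbits to marked sets -/

/-- The lift of the components with degrees in `s` to marked sets. -/
def lift (s : Finset ℕ) : M.Hilb →L[ℝ] M.MarkedL2 :=
  pull M.unmark (fun k => if M.size k ∈ s then 1 else 0) (s.sup id : ℕ) (fun o t ht => by
    by_cases h : M.deg o ∈ s
    · calc ∑ k ∈ t, (if M.size k ∈ s then (1 : ℝ) else 0) ^ 2 ≤ ∑ k ∈ t, 1 := by
            refine Finset.sum_le_sum fun k _ => ?_
            split_ifs <;> norm_num
        _ = t.card := by simp
        _ ≤ (s.sup id : ℕ) := by
            exact_mod_cast (M.card_fiber_le o t ht).trans (Finset.le_sup (f := id) h)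
    · rw [Finset.sum_eq_zero]
      · positivity
      · intro k hk
        rw [size, ht k hk, if_neg h]
        norm_num)

theorem lift_apply (s : Finset ℕ) (u : M.Hilb) (k : M.Marked) :
    M.lift s u k = if M.size k ∈ s then u (M.unmark k) else 0 := by
  rw [lift, pull_apply]
  split_ifs <;> simp

/-! ### Projections by degree -/

open Classical in
/-- The projection on the components whose degrees satisfy `P`. -/
def cut (P : ℕ → Prop) : M.Hilb →L[ℝ] M.Hilb :=
  pull id (fun o => if P (M.deg o) then 1 else 0) (1 ^ 2)
    (fiber_bound_of_injective Function.injective_id fun o => by split_ifs <;> simp)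

open Classical in
theorem cut_apply (P : ℕ → Prop) (u : M.Hilb) (o : M.Orbit) :
    M.cut P u o = if P (M.deg o) then u o else 0 := by
  rw [cut, pull_apply]
  split_ifs <;> simp

theorem proj_eq_cut (n : ℕ) (u : M.Hilb) : M.proj n u = M.cut (· ≤ n) u := by
  ext o
  rw [cut_apply]
  simp only [proj]

theorem inner_cut (P : ℕ → Prop) (u w : M.Hilb) :
    inner ℝ (M.cut P u) w = inner ℝ u (M.cut P w) := by
  refine inner_congr fun o => ?_
  rw [cut_apply, cut_apply]
  split_ifs <;> simp

theorem cut_cut (P P' : ℕ → Prop) (u : M.Hilb) : M.cut P (M.cut P' u) =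
    M.cut (fun n => P n ∧ P' n) u := by
  ext o
  simp only [cut_apply]
  split_ifs <;> simp_all

theorem norm_cut_le (P : ℕ → Prop) (u : M.Hilb) : ‖M.cut P u‖ ≤ ‖u‖ := by
  have h1 : inner ℝ (M.cut P u) (M.cut P u) = inner ℝ u (M.cut P u) := by
    rw [inner_cut, cut_cut]
    simp only [and_self]
  have h2 := real_inner_le_norm u (M.cut P u)
  rw [← h1, real_inner_self_eq_norm_mul_norm] at h2
  rcases (norm_nonneg (M.cut P u)).eq_or_lt' with h0 | h0
  · rw [h0]; exact norm_nonneg _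
  · exact le_of_mul_le_mul_right h2 h0

theorem cut_add_cut_not (P : ℕ → Prop) (u : M.Hilb) : M.cut P u + M.cut (fun n => ¬P n) u = u := by
  ext o
  rw [lp.coeFn_add, Pi.add_apply, cut_apply, cut_apply]
  split_ifs <;> simp

open Classical in
theorem lift_cut_apply (s : Finset ℕ) (P : ℕ → Prop) (u : M.Hilb) (k : M.Marked) :
    M.lift s (M.cut P u) k = if P (M.size k) then M.lift s u k else 0 := by
  rw [lift_apply, lift_apply, cut_apply]
  simp only [size]
  split_ifs <;> simp_all

/-- The lift of the components of degree at most `n`. -/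
abbrev liftLE (n : ℕ) : M.Hilb →L[ℝ] M.MarkedL2 := M.lift (Finset.range (n + 1))

theorem lift_apply_of_mem {s : Finset ℕ} (u : M.Hilb) {k : M.Marked} (hk : M.size k ∈ s) :
    M.lift s u k = u (M.unmark k) := by rw [lift_apply, if_pos hk]

theorem lift_apply_of_notMem {s : Finset ℕ} (u : M.Hilb) {k : M.Marked} (hk : M.size k ∉ s) :
    M.lift s u k = 0 := by rw [lift_apply, if_neg hk]

theorem lift_eq_of_cut_eq {s t : Finset ℕ} {P : ℕ → Prop} {u : M.Hilb} (hu : M.cut P u = u)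
    (h : ∀ n, P n → (n ∈ s ↔ n ∈ t)) : M.lift s u = M.lift t u := by
  ext k
  rw [← hu, lift_cut_apply, lift_cut_apply]
  split_ifs with hk
  · rw [lift_apply, lift_apply]
    simp only [h _ hk]
  · rfl

/-! ### Truncated generators, their symmetric and skew parts -/

/-- The symmetric part of the truncated generator. -/
def symTrunc (n : ℕ) : M.Hilb →L[ℝ] M.Hilb :=
  (adjoint (M.liftLE n)).comp (M.symOp.comp (M.liftLE n))

/-- The skew part of the truncated generator. -/
def skewTrunc (n : ℕ) : M.Hilb →L[ℝ] M.Hilb :=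
  -(adjoint (M.liftLE n)).comp (M.skewOp.comp (M.liftLE n))

/-- The generator on functions of degree at most `n`. -/
def genLE (n : ℕ) : M.Hilb →L[ℝ] M.Hilb :=
  (adjoint (M.liftLE (n + 1))).comp ((M.symOp - M.skewOp).comp (M.liftLE n))

theorem inner_symTrunc (n : ℕ) (u w : M.Hilb) :
    inner ℝ u (M.symTrunc n w) = inner ℝ (M.symOp (M.liftLE n u)) (M.liftLE n w) := by
  simp only [symTrunc, ContinuousLinearMap.comp_apply, adjoint_inner_right, inner_symOp]

theorem inner_skewTrunc (n : ℕ) (u w : M.Hilb) :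
    inner ℝ u (M.skewTrunc n w) = inner ℝ (M.skewOp (M.liftLE n u)) (M.liftLE n w) := by
  simp only [skewTrunc, ContinuousLinearMap.comp_apply, neg_apply,
    inner_neg_right, adjoint_inner_right, inner_skewOp]

/-- The weak form moves the operators to the test function `u`, where the skew part appears with a
plus sign. Since `w` only enters through degrees at most `n`, degrees up to `n + 1` of `u` suffice.
-/
theorem inner_genLE (n : ℕ) (u w : M.Hilb) :
    inner ℝ u (M.genLE n w) = inner ℝ (M.symOp (M.liftLE (n + 1) u)) (M.liftLE n w) +
      inner ℝ (M.skewOp (M.liftLE (n + 1) u)) (M.liftLE n w) := by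
  simp only [genLE, ContinuousLinearMap.comp_apply, sub_apply,
    adjoint_inner_right, inner_sub_right, inner_skewOp, inner_symOp]
  ring

theorem symTrunc_symm (n : ℕ) (u w : M.Hilb) :
    inner ℝ (M.symTrunc n u) w = inner ℝ u (M.symTrunc n w) := by
  rw [real_inner_comm, inner_symTrunc, inner_symTrunc, inner_symOp, real_inner_comm]

theorem symTrunc_nonpos (n : ℕ) (u : M.Hilb) : inner ℝ u (M.symTrunc n u) ≤ 0 := by
  rw [inner_symTrunc, inner_symOp]
  exact M.inner_symOp_nonpos _

theorem skewTrunc_skew (n : ℕ) (u w : M.Hilb) :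
    inner ℝ (M.skewTrunc n u) w = -inner ℝ u (M.skewTrunc n w) := by
  rw [real_inner_comm, inner_skewTrunc, inner_skewTrunc, inner_skewOp, real_inner_comm]

theorem inner_skewOp_self (h : M.MarkedL2) : inner ℝ (M.skewOp h) h = 0 := by
  have h1 := M.inner_skewOp h h
  rw [real_inner_comm] at h1
  have h2 := real_inner_comm (M.skewOp h) h
  linarith

theorem liftLE_eq_of_cut_eq {n m : ℕ} (h : n ≤ m) {u : M.Hilb} (hu : M.cut (· ≤ n) u = u) :
    M.liftLE m u = M.liftLE n u :=
  M.lift_eq_of_cut_eq hu fun k hk => by simp only [Finset.mem_range]; omega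

theorem liftLE_cut {n m : ℕ} (h : n ≤ m) (u : M.Hilb) :
    M.liftLE m (M.cut (· ≤ n) u) = M.liftLE n u := by
  rw [M.liftLE_eq_of_cut_eq h (by rw [cut_cut]; simp)]
  ext k
  rw [lift_cut_apply]
  split_ifs with hk
  · rfl
  · rw [lift_apply_of_notMem]
    simp only [Finset.mem_range]
    omega

/-- The operators `genLE n` are restrictions of one operator. -/
theorem genLE_eq {n m : ℕ} (h : n ≤ m) {u : M.Hilb} (hu : M.cut (· ≤ n) u = u) :
    M.genLE m u = M.genLE n u := by
  refine ext_inner_left ℝ fun w => ?_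
  rw [inner_genLE, inner_genLE, M.liftLE_eq_of_cut_eq h hu]
  congr 1
  all_goals
    refine inner_congr fun k => ?_
    by_cases hk : M.size k ∈ Finset.range (n + 1)
    swap
    · rw [M.lift_apply_of_notMem u hk, mul_zero, mul_zero]
    · congr 1
      first
      | refine M.symOp_congr fun k' hk' => ?_
      | refine M.skewOp_congr fun k' hk' => ?_
      rw [Finset.mem_range] at hk
      rw [lift_apply_of_mem, lift_apply_of_mem] <;> (rw [Finset.mem_range]; omega)

theorem genLE_cut (n : ℕ) (u : M.Hilb) : M.genLE n (M.cut (· ≤ n) u) = M.genLE n u := by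
  simp only [genLE, ContinuousLinearMap.comp_apply, M.liftLE_cut le_rfl]

/-- Thus P_n L P_n is bounded and everywhere defined, and splits into a symmetric and a skew
operator. -/
theorem cut_genLE (n : ℕ) (u : M.Hilb) :
    M.cut (· ≤ n) (M.genLE n u) = M.symTrunc n u + M.skewTrunc n u := by
  refine ext_inner_left ℝ fun w => ?_
  rw [← inner_cut, inner_genLE, M.liftLE_cut (Nat.le_succ n), inner_add_right, inner_symTrunc,
    inner_skewTrunc]

theorem inner_genLE_nonpos {n : ℕ} {u : M.Hilb} (hu : M.cut (· ≤ n) u = u) :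
    inner ℝ u (M.genLE n u) ≤ 0 := by
  rw [inner_genLE, M.liftLE_eq_of_cut_eq (Nat.le_succ n) hu, inner_skewOp_self, inner_symOp,
    add_zero]
  exact M.inner_symOp_nonpos _

theorem symTrunc_eq {n m : ℕ} (h : n ≤ m) {u : M.Hilb} (hu : M.cut (· ≤ n) u = u) :
    M.symTrunc m u = M.symTrunc n u := by
  refine ext_inner_left ℝ fun w => ?_
  rw [inner_symTrunc, inner_symTrunc, M.liftLE_eq_of_cut_eq h hu]
  refine inner_congr fun k => ?_
  by_cases hk : M.size k ∈ Finset.range (n + 1)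
  swap
  · rw [M.lift_apply_of_notMem u hk, mul_zero, mul_zero]
  · congr 1
    refine M.symOp_congr fun k' hk' => ?_
    rw [Finset.mem_range] at hk
    rw [lift_apply_of_mem, lift_apply_of_mem] <;> (rw [Finset.mem_range]; omega)

/-- The skew part raises the degree by at most one, so below degree `n` the truncation at `n` loses
nothing. -/
theorem skewTrunc_eq {n m l : ℕ} (hl : l < n) (h : n ≤ m) {u : M.Hilb}
    (hu : M.cut (· ≤ l) u = u) : M.skewTrunc m u = M.skewTrunc n u := by
  refine ext_inner_left ℝ fun w => ?_
  rw [inner_skewTrunc, inner_skewTrunc, M.liftLE_eq_of_cut_eq (hl.le.trans h) hu,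
    M.liftLE_eq_of_cut_eq hl.le hu]
  refine inner_congr fun k => ?_
  by_cases hk : M.size k ∈ Finset.range (l + 1)
  swap
  · rw [M.lift_apply_of_notMem u hk, mul_zero, mul_zero]
  · congr 1
    refine M.skewOp_congr fun k' hk' => ?_
    rw [Finset.mem_range] at hk
    rw [lift_apply_of_mem, lift_apply_of_mem] <;> (rw [Finset.mem_range]; omega)

/-- In degree `n` the truncation does change the image of `u`, but only by a component of degree `n
+ 1`, to which `w` is orthogonal. -/
theorem inner_skewTrunc_eq {n m : ℕ} (h : n ≤ m) {u w : M.Hilb} (hu : M.cut (· ≤ n) u = u)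
    (hw : M.cut (· ≤ n) w = w) :
    inner ℝ (M.skewTrunc n u) w = inner ℝ (M.skewTrunc m u) w := by
  rw [skewTrunc_skew, skewTrunc_skew, inner_skewTrunc, inner_skewTrunc,
    M.liftLE_eq_of_cut_eq h hu, M.liftLE_eq_of_cut_eq h hw]

theorem cut_symTrunc (P : ℕ → Prop) (n : ℕ) (u : M.Hilb) :
    M.cut P (M.symTrunc n u) = M.symTrunc n (M.cut P u) := by
  refine ext_inner_left ℝ fun w => ?_
  rw [← inner_cut, inner_symTrunc, inner_symTrunc]
  refine inner_congr fun k => ?_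
  rw [lift_cut_apply]
  by_cases hk : P (M.size k)
  · rw [if_pos hk]
    congr 1
    refine M.symOp_congr fun k' hk' => ?_
    rw [lift_cut_apply, hk', if_pos hk]
  · rw [if_neg hk, mul_zero, M.symOp_congr (h' := 0), map_zero]
    · simp
    · intro k' hk'
      rw [lift_cut_apply, hk', if_neg hk]
      rfl

/-- Meant for parities: the skew part exchanges even and odd degrees. -/
theorem cut_skewTrunc {P P' : ℕ → Prop} (hP : ∀ n, P (n + 1) ↔ P' n) (hP' : ∀ n, P' (n + 1) ↔ P n)
    (n : ℕ) (u : M.Hilb) : M.cut P (M.skewTrunc n u) = M.skewTrunc n (M.cut P' u) := by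
  have key : ∀ k k' : M.Marked, M.size k' = M.size k + 1 ∨ M.size k' + 1 = M.size k →
      (P (M.size k') ↔ P' (M.size k)) := by
    rintro k k' (h | h)
    · rw [h, hP]
    · rw [← h, hP']
  refine ext_inner_left ℝ fun w => ?_
  rw [← inner_cut, inner_skewTrunc, inner_skewTrunc]
  refine inner_congr fun k => ?_
  rw [lift_cut_apply]
  by_cases hk : P' (M.size k)
  · rw [if_pos hk]
    congr 1
    refine M.skewOp_congr fun k' hk' => ?_
    rw [lift_cut_apply, if_pos ((key k k' hk').mpr hk)]
  · rw [if_neg hk, mul_zero, M.skewOp_congr (h' := 0), map_zero]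
    · simp
    · intro k' hk'
      rw [lift_cut_apply, if_neg fun h => hk ((key k k' hk').mp h)]
      rfl

end

end LatticeGas

namespace LatticeGas

noncomputable section

variable {d : ℕ} (M : LatticeGas d)

/-! ### Uniqueness of the Fourier coefficients -/

theorem xi_true {η : M.Config} {p : M.Pt} (h : η p = true) : M.xi η p = 1 / 2 := by
  rw [xi, occ, if_pos h]; norm_num

theorem xi_false {η : M.Config} {p : M.Pt} (h : η p = false) : M.xi η p = -(1 / 2) := by
  rw [xi, occ, if_neg (by simp [h])]; norm_num

/-- The configuration with the particles in `T`. -/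
def indicatorConfig (T : Finset M.Pt) : M.Config := fun p => by classical exact decide (p ∈ T)

open Classical in
theorem xi_indicatorConfig (T : Finset M.Pt) (p : M.Pt) :
    M.xi (M.indicatorConfig T) p = if p ∈ T then 1 / 2 else -(1 / 2) := by
  split_ifs with h
  · exact M.xi_true (by simp [indicatorConfig, h])
  · exact M.xi_false (by simp [indicatorConfig, h])

-- Möbius inversion over the subsets of A. The alternating sum factorises over points: a point of A
-- ∩ B contributes 1/2 - (-1/2) = 1, a point of A \ B contributes 1 - 1 = 0, and a point of B \ A
-- keeps its value -1/2.
open Classical in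
theorem sum_powerset_Psi (A B : Finset M.Pt) :
    ∑ T ∈ A.powerset, (-1 : ℝ) ^ (A \ T).card * M.Psi B (M.indicatorConfig T) =
      if A ⊆ B then (∏ _p ∈ B \ A, (-(1 / 2) : ℝ)) else 0 := by
  have h1 : ∀ T ∈ A.powerset, (-1 : ℝ) ^ (A \ T).card * M.Psi B (M.indicatorConfig T) =
      (∏ _p ∈ B \ A, (-(1 / 2) : ℝ)) * ((∏ p ∈ T, if p ∈ B then (1 / 2 : ℝ) else 1) *
        ∏ p ∈ A \ T, if p ∈ B then (1 / 2 : ℝ) else -1) := by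
    intro T hT
    rw [Finset.mem_powerset] at hT
    have e1 : M.Psi B (M.indicatorConfig T) =
        (∏ _p ∈ B \ A, (-(1 / 2) : ℝ)) * ∏ p ∈ A, if p ∈ B then
          (if p ∈ T then (1 / 2 : ℝ) else -(1 / 2)) else 1 := by
      rw [Psi, ← Finset.prod_sdiff (Finset.inter_subset_left : B ∩ A ⊆ B), Finset.sdiff_inter_self_left]
      congr 1
      · refine Finset.prod_congr rfl fun p hp => ?_
        rw [xi_indicatorConfig, if_neg fun h => (Finset.mem_sdiff.mp hp).2 (hT h)]
      · rw [Finset.inter_comm, ← Finset.filter_mem_eq_inter, Finset.prod_filter]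
        exact Finset.prod_congr rfl fun p _ => by rw [xi_indicatorConfig]
    rw [e1, ← Finset.prod_const, mul_left_comm, ← Finset.prod_sdiff hT, ← mul_assoc (∏ p ∈ A \ T, _),
      ← Finset.prod_mul_distrib, mul_comm (∏ p ∈ T, _)]
    congr 2
    · refine Finset.prod_congr rfl fun p hp => ?_
      rw [if_neg (Finset.mem_sdiff.mp hp).2]
      split_ifs <;> norm_num
    · exact Finset.prod_congr rfl fun p hp => by rw [if_pos hp]
  rw [Finset.sum_congr rfl h1, ← Finset.mul_sum, ← Finset.prod_add]
  split_ifs with h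
  · rw [Finset.prod_eq_one (s := A), mul_one]
    intro p hp
    rw [if_pos (h hp), if_pos (h hp)]
    norm_num
  · obtain ⟨p, hp, hpB⟩ := Finset.not_subset.mp h
    rw [Finset.prod_eq_zero hp, mul_zero]
    rw [if_neg hpB, if_neg hpB]
    norm_num

theorem eval_injective : Function.Injective M.eval := by
  classical
  have key : ∀ f : Finset M.Pt →₀ ℝ, M.eval f = 0 → f = 0 := by
    intro f hf
    by_contra hne
    -- With A of maximal cardinality in the support, no other B in the support contains A, and the
    -- alternating sum isolates `f A`.
    obtain ⟨A, hA, hmax⟩ := Finset.exists_max_image f.support Finset.card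
      (Finsupp.support_nonempty_iff.mpr hne)
    have h1 : ∑ T ∈ A.powerset, (-1 : ℝ) ^ (A \ T).card * M.eval f (M.indicatorConfig T) = 0 := by
      simp [hf]
    have h2 : ∑ T ∈ A.powerset, (-1 : ℝ) ^ (A \ T).card * M.eval f (M.indicatorConfig T) =
        ∑ B ∈ f.support, f B * if A ⊆ B then (∏ _p ∈ B \ A, (-(1 / 2) : ℝ)) else 0 := by
      simp only [eval, Finsupp.sum, Finset.mul_sum, ← sum_powerset_Psi]
      rw [Finset.sum_comm]
      refine Finset.sum_congr rfl fun B _ => Finset.sum_congr rfl fun T _ => by ring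
    rw [h2, Finset.sum_eq_single A] at h1
    · simp at h1
      exact Finsupp.mem_support_iff.mp hA h1
    · intro B hB hBA
      rw [if_neg, mul_zero]
      intro hs
      exact hBA (Finset.eq_of_subset_of_card_le hs (hmax B hB)).symm
    · exact fun h => absurd hA h
  intro f g hfg
  rw [← sub_eq_zero]
  refine key _ ?_
  funext η
  rw [eval_sub, hfg, sub_self, Pi.zero_apply]

/-! ### The generator on the basis of local functions -/

open Classical in
theorem sum_finsum_mem (A : Finset M.Pt) (g : M.Pt → ℝ) :
    ∑ v : M.Vel, ∑ᶠ x : Fin d → ℤ, (if (x, v) ∈ A then g (x, v) else 0) = ∑ p ∈ A, g p := by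
  have h : ∀ v : M.Vel, ∑ᶠ x : Fin d → ℤ, (if (x, v) ∈ A then g (x, v) else 0) =
      ∑ x ∈ A.image Prod.fst, (if (x, v) ∈ A then g (x, v) else 0) := by
    intro v
    refine finsum_eq_sum_of_support_subset _ fun x hx => ?_
    have : (x, v) ∈ A := by
      by_contra hn
      simp [hn] at hx
    exact Finset.mem_coe.mpr (Finset.mem_image_of_mem Prod.fst this)
  rw [Finset.sum_congr rfl fun v _ => h v,
    ← Finset.sum_product_right' (A.image Prod.fst) Finset.univ
      (fun x v => if (x, v) ∈ A then g (x, v) else 0), ← Finset.sum_filter]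
  refine Finset.sum_congr ?_ fun p _ => rfl
  ext p
  simp only [Finset.mem_filter, Finset.mem_product, Finset.mem_univ, and_true,
    and_iff_right_iff_imp]
  exact fun hp => Finset.mem_image_of_mem Prod.fst hp

theorem Psi_exchange (A : Finset M.Pt) (x y : Fin d → ℤ) (v : M.Vel) (η : M.Config) :
    M.Psi A (M.exchange x y v η) = M.Psi (M.swapSet A (x, v) (y, v)) η := by
  rw [swapSet, Psi, Psi, Finset.prod_map]
  rfl

theorem xi_sq (η : M.Config) (p : M.Pt) : M.xi η p = 1 / 2 ∨ M.xi η p = -(1 / 2) := by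
  cases h : η p
  · exact Or.inr (M.xi_false h)
  · exact Or.inl (M.xi_true h)

/-- The term of the exclusion generator for a jump from `p` in the direction `s e_j`. -/
def jumpTerm (A : Finset M.Pt) (η : M.Config) (j : Fin d) (s : ℤ) (p : M.Pt) : ℝ :=
  M.occ η p * (1 - M.occ η (M.shift (Pi.single j s) p)) * M.jumpRate j s p.2 *
    (M.Psi (M.swapSet A p (M.shift (Pi.single j s) p)) η - M.Psi A η)

theorem swapSet_of_notMem {A : Finset M.Pt} {p q : M.Pt} (hp : p ∉ A) (hq : q ∉ A) :
    M.swapSet A p q = A := by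
  ext r
  rw [mem_swapSet, Equiv.swap_apply_def]
  split_ifs with h1 h2 <;> simp_all

theorem jumpTerm_eq_zero {A : Finset M.Pt} {η : M.Config} {j : Fin d} {s : ℤ} {p : M.Pt}
    (h : p ∈ A ↔ M.shift (Pi.single j s) p ∈ A) : M.jumpTerm A η j s p = 0 := by
  have : M.swapSet A p (M.shift (Pi.single j s) p) = A := by
    by_cases hp : p ∈ A
    · exact M.swapSet_of_mem hp (h.mp hp)
    · exact M.swapSet_of_notMem hp (mt h.mpr hp)
  rw [jumpTerm, this, sub_self, mul_zero]

theorem genEx_Psi_eq (A : Finset M.Pt) (η : M.Config) :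
    M.genEx (M.Psi A) η = ∑ v : M.Vel, ∑ j : Fin d, ∑ s ∈ ({1, -1} : Finset ℤ),
      ∑ᶠ x : Fin d → ℤ, M.jumpTerm A η j s (x, v) := by
  simp only [genEx, Psi_exchange]
  rfl

theorem finite_support_mem (A : Finset M.Pt) (v : M.Vel) : {x : Fin d → ℤ | (x, v) ∈ A}.Finite :=
  (A.finite_toSet.image Prod.fst).subset fun _ hx => ⟨_, hx, rfl⟩

theorem finite_support_jumpTerm (A : Finset M.Pt) (η : M.Config) (j : Fin d) (s : ℤ) (v : M.Vel) :
    (Function.support fun x : Fin d → ℤ => M.jumpTerm A η j s (x, v)).Finite := by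
  refine ((M.finite_support_mem A v).union (((M.finite_support_mem A v).preimage
    (add_left_injective (Pi.single j s : Fin d → ℤ)).injOn))).subset fun x hx => ?_
  by_contra hn
  simp only [Set.mem_union, Set.mem_preimage, Set.mem_ofPred_eq, not_or] at hn
  exact hx (M.jumpTerm_eq_zero (iff_of_false hn.1 hn.2))

-- A bond with both ends in A or both outside does not change Ψ_A. Every other bond has exactly one
-- end in A, and the two sums are indexed by that end: the start or the target of the jump.
open Classical in
theorem finsum_jumpTerm (A : Finset M.Pt) (η : M.Config) (j : Fin d) (s : ℤ) (v : M.Vel) :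
    ∑ᶠ x : Fin d → ℤ, M.jumpTerm A η j s (x, v) =
      (∑ᶠ x : Fin d → ℤ, if (x, v) ∈ A then M.jumpTerm A η j s (x, v) else 0) +
      ∑ᶠ x : Fin d → ℤ, if (x, v) ∈ A then
        M.jumpTerm A η j s (M.shift (Pi.single j (-s)) (x, v)) else 0 := by
  have h1 : ∀ x : Fin d → ℤ, M.jumpTerm A η j s (x, v) =
      (if (x, v) ∈ A then M.jumpTerm A η j s (x, v) else 0) +
      (if (x + Pi.single j s, v) ∈ A then M.jumpTerm A η j s (x, v) else 0) := by
    intro x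
    by_cases h1 : (x, v) ∈ A <;> by_cases h2 : (x + Pi.single j s, v) ∈ A
    · rw [M.jumpTerm_eq_zero (iff_of_true h1 h2)]; simp
    · simp [h1, h2]
    · simp [h1, h2]
    · rw [M.jumpTerm_eq_zero (iff_of_false h1 h2)]; simp
  rw [finsum_congr h1, finsum_add_distrib]
  · congr 1
    rw [← finsum_comp_equiv (Equiv.addRight (-(Pi.single j s : Fin d → ℤ)))]
    refine finsum_congr fun x => ?_
    simp only [Equiv.coe_addRight, neg_add_cancel_right, shift_apply, Pi.single_neg]
  · refine (M.finite_support_jumpTerm A η j s v).subset fun x hx h0 => hx ?_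
    simp [h0]
  · refine (M.finite_support_jumpTerm A η j s v).subset fun x hx h0 => hx ?_
    simp [h0]

theorem Psi_swapSet {A : Finset M.Pt} {p q : M.Pt} (hp : p ∈ A) (hq : q ∉ A.erase p) (η : M.Config) :
    M.Psi (M.swapSet A p q) η = M.xi η q * M.Psi (A.erase p) η := by
  classical
  have : M.swapSet A p q = insert q (A.erase p) := by
    ext r
    rw [mem_swapSet, Equiv.swap_apply_def, Finset.mem_insert, Finset.mem_erase]
    rw [Finset.mem_erase] at hq
    split_ifs with h1 h2 <;> grind
  rw [this, Psi, Psi, Finset.prod_insert hq]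

-- For an empty neighbour q, the asymmetric part of the two jumps is -(s v_j / 2)(ξ_p - ξ_q)² Ψ_{A \
-- p}, and (ξ_p - ξ_q)² = 1/2 - 2 ξ_p ξ_q. This yields the toggled set and a multiple of Ψ_{A \ p}.
-- For q in A the left side is 0, and the value 1/4 is chosen so that the same correction appears;
-- it is odd in s and does not depend on q, so it cancels between s = 1 and s = -1.
open Classical in
theorem jumpTerm_add {A : Finset M.Pt} {p : M.Pt} (hp : p ∈ A) (η : M.Config) (j : Fin d) {s : ℤ}
    (hs : s ∈ ({1, -1} : Finset ℤ)) :
    M.jumpTerm A η j s p + M.jumpTerm A η j (-s) (M.shift (Pi.single j s) p) =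
      (M.γ * (M.Psi (M.swapSet A p (M.shift (Pi.single j s) p)) η - M.Psi A η) +
        s * (p.2 : Fin d → ℝ) j * ((if M.shift (Pi.single j s) p ∈ A then 1 / 4 else 1) *
          M.Psi (M.toggleSet A p (M.shift (Pi.single j s) p)) η)) -
      s * ((p.2 : Fin d → ℝ) j * (1 / 4) * M.Psi (A.erase p) η) := by
  have hne : M.shift (Pi.single j s) p ≠ p := M.shift_ne (single_ne_zero j hs) p
  have hback : M.shift (Pi.single j (-s)) (M.shift (Pi.single j s) p) = p := by
    rw [Pi.single_neg, shift_neg]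
  by_cases hq : M.shift (Pi.single j s) p ∈ A
  · rw [M.jumpTerm_eq_zero (iff_of_true hp hq), M.jumpTerm_eq_zero (by rw [hback]; tauto),
      M.swapSet_of_mem hp hq, if_pos hq, toggleSet, if_pos (Finset.mem_erase.mpr ⟨hne, hq⟩)]
    ring
  · rw [jumpTerm, jumpTerm, hback, if_neg hq]
    have hv : (M.shift (Pi.single j s) p).2 = p.2 := rfl
    rw [hv]
    have hq' : M.shift (Pi.single j s) p ∉ A.erase p := fun h => hq (Finset.mem_of_mem_erase h)
    have e1 : M.swapSet A (M.shift (Pi.single j s) p) p =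
        M.swapSet A p (M.shift (Pi.single j s) p) := by
      rw [swapSet, swapSet, Equiv.swap_comm]
    rw [e1, M.Psi_swapSet hp hq', toggleSet, if_neg hq']
    have e2 : M.Psi (insert (M.shift (Pi.single j s) p) A) η =
        M.xi η (M.shift (Pi.single j s) p) * M.Psi A η := by
      rw [Psi, Finset.prod_insert hq]; rfl
    have e3 : M.Psi A η = M.xi η p * M.Psi (A.erase p) η := (Finset.mul_prod_erase _ _ hp).symm
    rw [e2, e3]
    have o1 : ∀ p, M.occ η p = M.xi η p + 1 / 2 := fun p => by rw [xi]; ring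
    simp only [o1, jumpRate]
    push_cast
    rcases M.xi_sq η p with h1 | h1 <;> rcases M.xi_sq η (M.shift (Pi.single j s) p) with h2 | h2 <;>
      rw [h1, h2] <;> ring

open Classical in
theorem genEx_Psi (A : Finset M.Pt) (η : M.Config) :
    M.genEx (M.Psi A) η = ∑ p ∈ A, ∑ j : Fin d, ∑ s ∈ ({1, -1} : Finset ℤ),
      (M.γ * (M.Psi (M.swapSet A p (M.shift (Pi.single j s) p)) η - M.Psi A η) +
        s * (p.2 : Fin d → ℝ) j * ((if M.shift (Pi.single j s) p ∈ A then 1 / 4 else 1) *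
          M.Psi (M.toggleSet A p (M.shift (Pi.single j s) p)) η)) := by
  have h1 : ∀ j : Fin d, ∀ p ∈ A, ∑ s ∈ ({1, -1} : Finset ℤ),
      (M.jumpTerm A η j s p + M.jumpTerm A η j s (M.shift (Pi.single j (-s)) p)) =
      ∑ s ∈ ({1, -1} : Finset ℤ),
      (M.γ * (M.Psi (M.swapSet A p (M.shift (Pi.single j s) p)) η - M.Psi A η) +
        s * (p.2 : Fin d → ℝ) j * ((if M.shift (Pi.single j s) p ∈ A then 1 / 4 else 1) *
          M.Psi (M.toggleSet A p (M.shift (Pi.single j s) p)) η)) := by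
    intro j p hp
    have a1 := M.jumpTerm_add hp η j (s := 1) (by simp)
    have a2 := M.jumpTerm_add hp η j (s := -1) (by simp)
    rw [Finset.sum_pair (by norm_num), Finset.sum_pair (by norm_num)]
    rw [neg_neg] at a2 ⊢
    push_cast at a1 a2 ⊢
    linarith
  calc M.genEx (M.Psi A) η
      = ∑ j : Fin d, ∑ s ∈ ({1, -1} : Finset ℤ), ∑ v : M.Vel,
          ∑ᶠ x : Fin d → ℤ, M.jumpTerm A η j s (x, v) := by
        rw [genEx_Psi_eq, Finset.sum_comm]
        exact Finset.sum_congr rfl fun j _ => Finset.sum_comm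
    _ = ∑ j : Fin d, ∑ s ∈ ({1, -1} : Finset ℤ), ∑ p ∈ A,
          (M.jumpTerm A η j s p + M.jumpTerm A η j s (M.shift (Pi.single j (-s)) p)) := by
        refine Finset.sum_congr rfl fun j _ => Finset.sum_congr rfl fun s _ => ?_
        simp only [finsum_jumpTerm, Finset.sum_add_distrib]
        congr 1
        · exact M.sum_finsum_mem A (M.jumpTerm A η j s)
        · exact M.sum_finsum_mem A fun p => M.jumpTerm A η j s (M.shift (Pi.single j (-s)) p)
    _ = ∑ j : Fin d, ∑ p ∈ A, ∑ s ∈ ({1, -1} : Finset ℤ),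
          (M.jumpTerm A η j s p + M.jumpTerm A η j s (M.shift (Pi.single j (-s)) p)) :=
        Finset.sum_congr rfl fun j _ => Finset.sum_comm
    _ = _ := by
        rw [Finset.sum_comm]
        exact Finset.sum_congr rfl fun p hp => Finset.sum_congr rfl fun j _ => h1 j p hp

/-! ### The collision operator on the basis -/

/-- The factor of `Ψ_A` at the sites different from `x`. -/
def PsiOff (A : Finset M.Pt) (x : Fin d → ℤ) (η : M.Config) : ℝ :=
  ∏ p ∈ A with p.1 ≠ x, M.xi η p

/-- The two values of a centred occupation number. -/
def spin (b : Bool) : ℝ := if b = true then 1 / 2 else -(1 / 2)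

theorem xi_setSite (x : Fin d → ℤ) (ζ : M.Vel → Bool) (η : M.Config) (p : M.Pt) :
    M.xi (M.setSite x ζ η) p = if p.1 = x then spin (ζ p.2) else M.xi η p := by
  simp only [xi, occ, setSite, spin]
  split_ifs <;> norm_num

open Classical in
theorem Psi_setSite (A : Finset M.Pt) (x : Fin d → ℤ) (ζ : M.Vel → Bool) (η : M.Config) :
    M.Psi A (M.setSite x ζ η) =
      M.PsiOff A x η * ∏ v : M.Vel, if (x, v) ∈ A then spin (ζ v) else 1 := by
  rw [Psi, ← Finset.prod_filter_not_mul_prod_filter A (fun p => p.1 = x), PsiOff]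
  congr 1
  · refine Finset.prod_congr rfl fun p hp => ?_
    rw [xi_setSite, if_neg (Finset.mem_filter.mp hp).2]
  · rw [← Finset.prod_filter]
    refine Finset.prod_nbij' (fun p => p.2) (fun v => (x, v)) ?_ ?_ ?_ ?_ ?_
    · intro p hp
      obtain ⟨h1, h2⟩ := Finset.mem_filter.mp hp
      simpa [← h2] using h1
    · intro v hv
      simpa using hv
    · intro p hp
      obtain ⟨h1, h2⟩ := Finset.mem_filter.mp hp
      simp [← h2]
    · intro v _
      rfl
    · intro p hp
      rw [xi_setSite, if_pos (Finset.mem_filter.mp hp).2]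

theorem phi_eq_sum (x : Fin d → ℤ) (q : M.Vel × M.Vel × M.Vel × M.Vel) (η : M.Config) :
    M.phi x q η = ∑ u, M.phiCoeff q u * M.xi η (x, u) := by
  simp only [phi, phiCoeff, sub_mul, add_mul, Finset.sum_sub_distrib, Finset.sum_add_distrib,
    ite_mul, one_mul, zero_mul, Finset.sum_ite_eq, Finset.mem_univ, if_true]

/-- The integral factorises; a spin has mean 0 and square 1/4, so only the product consisting of the
spin u alone survives. Hence the collision operator sees only sites that carry exactly one point of
A. -/
theorem sum_spin {α : Type*} [Fintype α] [DecidableEq α] (P : α → Prop) [DecidablePred P] (u : α) :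
    (∑ ζ : α → Bool, (∏ v, if P v then spin (ζ v) else 1) * spin (ζ u)) / 2 ^ Fintype.card α =
      if ∀ v, P v ↔ v = u then 1 / 4 else 0 := by
  have h1 : ∀ ζ : α → Bool, (∏ v, if P v then spin (ζ v) else 1) * spin (ζ u) =
      ∏ v, ((if P v then spin (ζ v) else 1) * if v = u then spin (ζ v) else 1) := by
    intro ζ
    rw [Finset.prod_mul_distrib]
    simp
  have h2 : ∑ ζ : α → Bool, (∏ v, if P v then spin (ζ v) else 1) * spin (ζ u) =
      ∏ v, ∑ b : Bool, ((if P v then spin b else 1) * if v = u then spin b else 1) := by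
    rw [Finset.prod_univ_sum, Fintype.piFinset_univ]
    exact Finset.sum_congr rfl fun ζ _ => h1 ζ
  have h3 : (2 : ℝ) ^ Fintype.card α = ∏ _v : α, (2 : ℝ) := by simp
  rw [h2, h3, ← Finset.prod_div_distrib]
  simp only [Fintype.sum_bool]
  split_ifs with h
  · rw [Finset.prod_eq_single u]
    · simp [h, spin]; norm_num
    · intro v _ hv
      simp [h, hv]
    · simp
  · push Not at h
    obtain ⟨v, hv⟩ := h
    refine Finset.prod_eq_zero (Finset.mem_univ v) ?_
    rcases hv with ⟨hv1, hv2⟩ | ⟨hv1, rfl⟩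
    · simp [hv1, hv2, spin]
    · simp [hv1, spin]

open Classical in
theorem siteInner_Psi_phi (A : Finset M.Pt) (x : Fin d → ℤ) (q : M.Vel × M.Vel × M.Vel × M.Vel)
    (η : M.Config) :
    M.siteInner x (M.Psi A) (M.phi x q) η = M.PsiOff A x η *
      ∑ u, M.phiCoeff q u * if ∀ v, (x, v) ∈ A ↔ v = u then 1 / 4 else 0 := by
  have h : ∀ ζ : M.Vel → Bool, M.Psi A (M.setSite x ζ η) * M.phi x q (M.setSite x ζ η) =
      ∑ u, M.PsiOff A x η * (M.phiCoeff q u *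
        ((∏ v, if (x, v) ∈ A then spin (ζ v) else 1) * spin (ζ u))) := by
    intro ζ
    rw [phi_eq_sum, Psi_setSite, Finset.mul_sum]
    refine Finset.sum_congr rfl fun u _ => ?_
    rw [xi_setSite, if_pos rfl]
    ring
  rw [siteInner, Finset.sum_congr rfl fun ζ _ => h ζ, Finset.sum_comm, Finset.sum_div,
    Finset.mul_sum]
  refine Finset.sum_congr rfl fun u _ => ?_
  rw [← Finset.mul_sum, ← Finset.mul_sum, mul_div_assoc, mul_div_assoc,
    sum_spin (fun v => (x, v) ∈ A) u]

theorem siteInner_phi_phi (x : Fin d → ℤ) (q : M.Vel × M.Vel × M.Vel × M.Vel) (η : M.Config) :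
    M.siteInner x (M.phi x q) (M.phi x q) η = M.phiNormSq q / 4 := by
  classical
  have h : M.siteInner x (M.phi x q) (M.phi x q) η =
      ∑ w, M.phiCoeff q w * M.siteInner x (M.Psi {(x, w)}) (M.phi x q) η := by
    simp only [siteInner]
    simp_rw [← mul_div_assoc, ← Finset.sum_div, Finset.mul_sum]
    rw [Finset.sum_comm]
    congr 1
    refine Finset.sum_congr rfl fun ζ _ => ?_
    nth_rw 1 [phi_eq_sum]
    rw [Finset.sum_mul]
    refine Finset.sum_congr rfl fun w _ => ?_
    rw [Psi, Finset.prod_singleton]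
    ring
  rw [h, phiNormSq, Finset.sum_div]
  refine Finset.sum_congr rfl fun w _ => ?_
  have h1 : M.PsiOff {(x, w)} x η = 1 := by
    rw [PsiOff, Finset.prod_eq_one]
    intro p hp
    simp only [Finset.mem_filter, Finset.mem_singleton] at hp
    exact absurd (by rw [hp.1]) hp.2
  have h2 : ∀ u, (∀ v, (x, v) ∈ ({(x, w)} : Finset M.Pt) ↔ v = u) ↔ u = w := by
    intro u
    simp only [Finset.mem_singleton, Prod.mk.injEq, true_and]
    constructor
    · intro h
      exact (h u).mpr rfl
    · rintro rfl v
      rfl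
  rw [siteInner_Psi_phi, h1]
  simp only [h2, mul_ite, mul_zero, Finset.sum_ite_eq', Finset.mem_univ, if_true]
  ring

theorem PsiOff_mul_xi {A : Finset M.Pt} {x : Fin d → ℤ} {u : M.Vel}
    (h : ∀ v, (x, v) ∈ A ↔ v = u) (w : M.Vel) (η : M.Config) :
    M.PsiOff A x η * M.xi η (x, w) = M.Psi (M.swapSet A (x, u) (x, w)) η := by
  classical
  have hu : (x, u) ∈ A := (h u).mpr rfl
  have e : A.filter (fun p => p.1 ≠ x) = A.erase (x, u) := by
    ext p
    obtain ⟨y, v⟩ := p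
    simp only [Finset.mem_filter, Finset.mem_erase, ne_eq, Prod.mk.injEq, not_and]
    constructor
    · exact fun hp => ⟨fun h' => absurd h' hp.2, hp.1⟩
    · rintro ⟨h1, h2⟩
      refine ⟨h2, ?_⟩
      rintro rfl
      exact h1 rfl ((h v).mp h2)
  rw [M.Psi_swapSet hu, PsiOff, e, mul_comm]
  · rfl
  · intro hw
    obtain ⟨h1, h2⟩ := Finset.mem_erase.mp hw
    exact h1 (by rw [(h w).mp h2])

open Classical in
theorem genCollAt_Psi (A : Finset M.Pt) (x : Fin d → ℤ) (q : M.Vel × M.Vel × M.Vel × M.Vel)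
    (η : M.Config) :
    M.genCollAt x q (M.Psi A) η = ∑ u, if ∀ v, (x, v) ∈ A ↔ v = u then
      -4 * ∑ w, M.phiCoeff q u * M.phiCoeff q w / M.phiNormSq q *
        M.Psi (M.swapSet A (x, u) (x, w)) η else 0 := by
  rw [genCollAt, siteInner_Psi_phi, siteInner_phi_phi]
  rw [Finset.mul_sum, Finset.sum_div, Finset.mul_sum, Finset.sum_mul]
  refine Finset.sum_congr rfl fun u _ => ?_
  split_ifs with h
  · rw [phi_eq_sum, Finset.mul_sum, Finset.mul_sum]
    refine Finset.sum_congr rfl fun w _ => ?_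
    rw [← M.PsiOff_mul_xi h]
    field_simp
  · simp

theorem finite_support_genCollAt (A : Finset M.Pt) (η : M.Config) :
    (Function.support fun x : Fin d → ℤ => ∑ q ∈ M.Q, M.genCollAt x q (M.Psi A) η).Finite := by
  classical
  refine (A.finite_toSet.image Prod.fst).subset fun x hx => ?_
  by_contra hn
  refine hx (Finset.sum_eq_zero fun q _ => ?_)
  rw [genCollAt_Psi]
  refine Finset.sum_eq_zero fun u _ => if_neg fun h => hn ⟨(x, u), ?_, rfl⟩
  exact Finset.mem_coe.mpr ((h u).mpr rfl)

theorem mem_iff_eq_iff_lone (A : Finset M.Pt) (p : M.Pt) :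
    (∀ v, (p.1, v) ∈ A ↔ v = p.2) ↔ p ∈ A ∧ ∀ q ∈ A, q.1 = p.1 → q = p := by
  constructor
  · intro h
    refine ⟨(h p.2).mpr rfl, fun q hq hqp => Prod.ext hqp ((h q.2).mp ?_)⟩
    rw [← hqp]
    exact hq
  · rintro ⟨h1, h2⟩ v
    constructor
    · intro hv
      exact congrArg Prod.snd (h2 _ hv rfl)
    · rintro rfl
      exact h1

open Classical in
theorem genColl_Psi (A : Finset M.Pt) (η : M.Config) :
    M.genColl (M.Psi A) η = -∑ p ∈ A, ∑ q ∈ M.Q, ∑ u, ∑ w,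
      M.phiCoeff q u * M.phiCoeff q w / M.phiNormSq q *
        ((if (∀ p' ∈ A, p'.1 = p.1 → p' = p) ∧ p.2 = u then 1 else 0) *
          M.Psi (M.swapSet A (p.1, u) (p.1, w)) η) := by
  -- The contribution of a site is attributed to its only point in A, so that the sum over sites
  -- becomes a sum over A.
  let G : M.Pt → ℝ := fun p => if ∀ p' ∈ A, p'.1 = p.1 → p' = p then
    ∑ q ∈ M.Q, -4 * ∑ w, M.phiCoeff q p.2 * M.phiCoeff q w / M.phiNormSq q *
      M.Psi (M.swapSet A p (p.1, w)) η else 0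
  have h1 : ∀ x : Fin d → ℤ, ∑ q ∈ M.Q, M.genCollAt x q (M.Psi A) η =
      ∑ u, if (x, u) ∈ A then G (x, u) else 0 := by
    intro x
    simp only [genCollAt_Psi]
    rw [Finset.sum_comm]
    refine Finset.sum_congr rfl fun u _ => ?_
    have h := M.mem_iff_eq_iff_lone A (x, u)
    simp only at h
    simp only [h, G]
    by_cases hu : (x, u) ∈ A <;> by_cases hl : ∀ p' ∈ A, p'.1 = x → p' = (x, u)
    · simp only [hu, true_and, if_true]
      rw [if_pos hl]
      exact Finset.sum_congr rfl fun q _ => if_pos hl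
    · simp only [hu, true_and, if_true]
      rw [if_neg hl]
      exact Finset.sum_eq_zero fun q _ => if_neg hl
    · simp only [hu, false_and, if_false, Finset.sum_const_zero]
    · simp only [hu, false_and, if_false, Finset.sum_const_zero]
  rw [genColl, finsum_congr h1, finsum_sum_comm, sum_finsum_mem, Finset.mul_sum,
    ← Finset.sum_neg_distrib]
  · refine Finset.sum_congr rfl fun p _ => ?_
    simp only [G]
    split_ifs with hl
    · rw [Finset.mul_sum, ← Finset.sum_neg_distrib]
      refine Finset.sum_congr rfl fun q _ => ?_
      have e := Finset.sum_eq_single (s := Finset.univ) (f := fun u => ∑ w,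
        M.phiCoeff q u * M.phiCoeff q w / M.phiNormSq q *
        ((if (∀ p' ∈ A, p'.1 = p.1 → p' = p) ∧ p.2 = u then 1 else 0) *
          M.Psi (M.swapSet A (p.1, u) (p.1, w)) η)) p.2 (fun u _ hu => by
        refine Finset.sum_eq_zero fun w _ => ?_
        rw [if_neg fun h => hu h.2.symm, zero_mul, mul_zero]) (by simp)
      rw [e, if_pos ⟨hl, rfl⟩]
      simp only [one_mul]
      ring
    · rw [mul_zero, eq_comm, neg_eq_zero]
      refine Finset.sum_eq_zero fun q _ => Finset.sum_eq_zero fun u _ =>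
        Finset.sum_eq_zero fun w _ => ?_
      rw [if_neg fun h => hl h.1, zero_mul, mul_zero]
  · intro u _
    refine (M.finite_support_mem A u).subset fun x hx => ?_
    by_contra hn
    exact hx (if_neg hn)

/-! ### The generator on Fourier coefficients -/

theorem genEx_eval (f : Finset M.Pt →₀ ℝ) (η : M.Config) :
    M.genEx (M.eval f) η = ∑ A ∈ f.support, f A * M.genEx (M.Psi A) η := by
  simp only [genEx_Psi_eq, Finset.mul_sum]
  rw [Finset.sum_comm, genEx]
  refine Finset.sum_congr rfl fun v _ => ?_
  conv_rhs => rw [Finset.sum_comm]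
  refine Finset.sum_congr rfl fun j _ => ?_
  conv_rhs => rw [Finset.sum_comm]
  refine Finset.sum_congr rfl fun s _ => ?_
  have h1 : ∀ A ∈ f.support, f A * ∑ᶠ x : Fin d → ℤ, M.jumpTerm A η j s (x, v) =
      ∑ᶠ x : Fin d → ℤ, f A * M.jumpTerm A η j s (x, v) := fun A _ =>
    mul_finsum _ _
  rw [Finset.sum_congr rfl h1, ← finsum_sum_comm]
  · refine finsum_congr fun x => ?_
    simp only [eval, Finsupp.sum]
    rw [← Finset.sum_sub_distrib, Finset.mul_sum]
    refine Finset.sum_congr rfl fun A _ => ?_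
    rw [Psi_exchange, jumpTerm]
    simp only [shift_apply]
    ring
  · intro A _
    refine (M.finite_support_jumpTerm A η j s v).subset fun x hx h0 => hx ?_
    simp [h0]

theorem genColl_eval (f : Finset M.Pt →₀ ℝ) (η : M.Config) :
    M.genColl (M.eval f) η = ∑ A ∈ f.support, f A * M.genColl (M.Psi A) η := by
  simp only [genColl, mul_left_comm _ (1 / 4 : ℝ), ← Finset.mul_sum]
  congr 1
  have h1 : ∀ A ∈ f.support, f A * ∑ᶠ x : Fin d → ℤ, ∑ q ∈ M.Q, M.genCollAt x q (M.Psi A) η =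
      ∑ᶠ x : Fin d → ℤ, f A * ∑ q ∈ M.Q, M.genCollAt x q (M.Psi A) η := fun A _ =>
    mul_finsum _ _
  rw [Finset.sum_congr rfl h1, ← finsum_sum_comm]
  · refine finsum_congr fun x => ?_
    simp only [Finset.mul_sum]
    rw [Finset.sum_comm]
    refine Finset.sum_congr rfl fun q _ => ?_
    have h2 : M.siteInner x (M.eval f) (M.phi x q) η =
        ∑ A ∈ f.support, f A * M.siteInner x (M.Psi A) (M.phi x q) η := by
      simp only [siteInner, eval, Finsupp.sum, Finset.sum_mul]
      rw [Finset.sum_comm, Finset.sum_div]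
      refine Finset.sum_congr rfl fun A _ => ?_
      simp only [mul_assoc]
      rw [← Finset.mul_sum, mul_div_assoc]
    rw [genCollAt, h2, Finset.sum_div, Finset.mul_sum, Finset.sum_mul]
    refine Finset.sum_congr rfl fun A _ => ?_
    rw [genCollAt]
    ring
  · intro A _
    refine (M.finite_support_genCollAt A η).subset fun x hx h0 => hx ?_
    simp [h0]

open Classical in
/-- The Fourier coefficients of the image of `Ψ_A` under the generator. -/
def genCoeff (A : Finset M.Pt) : Finset M.Pt →₀ ℝ :=
  ∑ p ∈ A, ((∑ j : Fin d, ∑ s ∈ ({1, -1} : Finset ℤ),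
      (M.γ • (Finsupp.single (M.swapSet A p (M.shift (Pi.single j s) p)) 1 - Finsupp.single A 1) +
        (s * (p.2 : Fin d → ℝ) j) •
          Finsupp.single (M.toggleSet A p (M.shift (Pi.single j s) p))
            (if M.shift (Pi.single j s) p ∈ A then 1 / 4 else 1))) -
    ∑ q ∈ M.Q, ∑ u, ∑ w, (M.phiCoeff q u * M.phiCoeff q w / M.phiNormSq q) •
      Finsupp.single (M.swapSet A (p.1, u) (p.1, w))
        (if (∀ p' ∈ A, p'.1 = p.1 → p' = p) ∧ p.2 = u then 1 else 0))

/-- The generator on Fourier coefficients. -/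
def genCoeffs : (Finset M.Pt →₀ ℝ) →ₗ[ℝ] (Finset M.Pt →₀ ℝ) :=
  Finsupp.linearCombination ℝ M.genCoeff

theorem eval_genCoeff (A : Finset M.Pt) (η : M.Config) :
    M.eval (M.genCoeff A) η = M.gen (M.Psi A) η := by
  classical
  rw [gen, genEx_Psi, genColl_Psi, ← sub_eq_add_neg, ← Finset.sum_sub_distrib]
  simp only [genCoeff, eval_sum, eval_sub, eval_add, eval_smul, eval_single, one_mul]

theorem eval_genCoeffs (f : Finset M.Pt →₀ ℝ) : M.eval (M.genCoeffs f) = M.gen (M.eval f) := by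
  funext η
  rw [gen, genEx_eval, genColl_eval, ← Finset.sum_add_distrib, genCoeffs,
    Finsupp.linearCombination_apply, Finsupp.sum, eval_sum]
  refine Finset.sum_congr rfl fun A _ => ?_
  rw [eval_smul, eval_genCoeff, gen, mul_add]

end

end LatticeGas

namespace LatticeGas

noncomputable section

variable {d : ℕ} (M : LatticeGas d)

/-! ### Classes of local functions -/

theorem finite_support_translate (f : Finset M.Pt →₀ ℝ) {A : Finset M.Pt} (hA : A.Nonempty) :
    (Function.support fun z : Fin d → ℤ => f (M.translate z A)).Finite := by
  refine (f.support.finite_toSet.preimage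
    (f := fun z => M.translate z A) fun z _ w _ h => M.translate_injective_left hA h).subset ?_
  intro z hz
  simpa using hz

theorem orbitSum_orb (f : Finset M.Pt →₀ ℝ) (A : Finset M.Pt) (hA : A.Nonempty) :
    M.orbitSum f (M.orb A hA) = ∑ᶠ z : Fin d → ℤ, f (M.translate z A) := rfl

theorem toHilb_apply (f : Finset M.Pt →₀ ℝ) (o : M.Orbit) :
    M.toHilb f o = (1 / 2 : ℝ) ^ M.deg o * M.orbitSum f o := rfl

/-- The class of a local function, as a linear map. -/
def toHilbLin : (Finset M.Pt →₀ ℝ) →ₗ[ℝ] M.Hilb where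
  toFun := M.toHilb
  map_add' f g := by
    ext o
    obtain ⟨A, hA, rfl⟩ := M.exists_orb o
    rw [lp.coeFn_add, Pi.add_apply, toHilb_apply, toHilb_apply, toHilb_apply, ← mul_add,
      orbitSum_orb, orbitSum_orb, orbitSum_orb]
    congr 1
    exact finsum_add_distrib (M.finite_support_translate f hA) (M.finite_support_translate g hA)
  map_smul' c f := by
    ext o
    obtain ⟨A, hA, rfl⟩ := M.exists_orb o
    rw [lp.coeFn_smul, Pi.smul_apply, toHilb_apply, toHilb_apply, orbitSum_orb, orbitSum_orb,
      RingHom.id_apply, smul_eq_mul, mul_left_comm]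
    congr 1
    rw [mul_finsum]
    rfl

theorem toHilbLin_apply (f : Finset M.Pt →₀ ℝ) : M.toHilbLin f = M.toHilb f := rfl

/-- The basis vector of an orbit. -/
def basisVec (o : M.Orbit) : M.Hilb := by classical exact lp.single 2 o (1 : ℝ)

theorem inner_basisVec (o : M.Orbit) (u : M.Hilb) : inner ℝ u (M.basisVec o) = u o := by
  classical
  rw [real_inner_comm, basisVec, lp.inner_single_left]
  simp

open Classical in
theorem basisVec_apply (o o' : M.Orbit) : M.basisVec o o' = if o' = o then 1 else 0 := by
  rw [basisVec, lp.single_apply]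
  simp only [Pi.single_apply]

theorem toHilbLin_single {A : Finset M.Pt} (hA : A.Nonempty) (c : ℝ) :
    M.toHilbLin (Finsupp.single A c) = ((1 / 2 : ℝ) ^ A.card * c) • M.basisVec (M.orb A hA) := by
  classical
  ext o
  obtain ⟨B, hB, rfl⟩ := M.exists_orb o
  rw [toHilbLin_apply, toHilb_apply, lp.coeFn_smul, Pi.smul_apply, basisVec_apply, smul_eq_mul,
    orbitSum_orb, deg_orb]
  by_cases h : M.orb B hB = M.orb A hA
  · obtain ⟨z, hz⟩ := M.orb_eq_orb.mp h
    have hcard : B.card = A.card := by rw [hz]; exact Finset.card_map _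
    have hA' : A = M.translate (-z) B := by
      rw [hz, translate_translate, add_neg_cancel, translate_zero]
    rw [if_pos h, mul_one, hcard, finsum_eq_single _ (-z), ← hA', Finsupp.single_eq_same]
    intro w hw
    rw [Finsupp.single_apply, if_neg]
    intro h'
    rw [hA'] at h'
    exact hw (M.translate_injective_left hB h').symm
  · rw [if_neg h, mul_zero, finsum_eq_zero_of_forall_eq_zero, mul_zero]
    intro w
    rw [Finsupp.single_apply, if_neg]
    intro h'
    refine h (M.orb_eq_orb.mpr ⟨-w, ?_⟩)
    rw [h', translate_translate, add_neg_cancel, translate_zero]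

theorem toHilbLin_single_empty (c : ℝ) : M.toHilbLin (Finsupp.single ∅ c) = 0 := by
  ext o
  obtain ⟨B, hB, rfl⟩ := M.exists_orb o
  rw [toHilbLin_apply, toHilb_apply, orbitSum_orb, finsum_eq_zero_of_forall_eq_zero, mul_zero]
  · rfl
  intro w
  rw [Finsupp.single_apply, if_neg]
  intro h'
  have := congrArg Finset.card h'
  rw [Finset.card_empty, translate, Finset.card_map] at this
  exact hB.card_pos.ne this

theorem inner_toHilbLin_single (u : M.Hilb) {A : Finset M.Pt} (hA : A.Nonempty) (c : ℝ) :
    inner ℝ u (M.toHilbLin (Finsupp.single A c)) =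
      (1 / 2 : ℝ) ^ A.card * c * u (M.orb A hA) := by
  rw [M.toHilbLin_single hA, inner_smul_right, inner_basisVec]

theorem cut_basisVec {P : ℕ → Prop} {o : M.Orbit} (h : P (M.deg o)) :
    M.cut P (M.basisVec o) = M.basisVec o := by
  classical
  ext o'
  rw [cut_apply, basisVec_apply]
  split_ifs with h1 h2 h2
  · rfl
  · rfl
  · rw [h2] at h1
    exact absurd h h1
  · rfl

theorem inner_liftLE_basisVec (h : M.MarkedL2) {n : ℕ} {A : Finset M.Pt} (hA : A.Nonempty)
    (hn : A.card ≤ n) :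
    inner ℝ h (M.liftLE n (M.basisVec (M.orb A hA))) =
      ∑ p ∈ A.attach, h (M.mark A p.1 p.2) := by
  classical
  rw [inner_eq_tsum_mul, M.tsum_fiber A hA]
  · refine Finset.sum_congr rfl fun p _ => ?_
    rw [lift_apply_of_mem, unmark_mark, basisVec_apply, if_pos rfl, mul_one]
    rw [size_mark, Finset.mem_range]
    omega
  · intro k hk
    rw [lift_apply, basisVec_apply, if_neg hk]
    simp

theorem liftLE_mark (u : M.Hilb) {n : ℕ} {A : Finset M.Pt} {p : M.Pt} (hp : p ∈ A)
    (hn : A.card ≤ n) : M.liftLE n u (M.mark A p hp) = u (M.orb A ⟨p, hp⟩) := by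
  rw [lift_apply_of_mem, unmark_mark]
  rw [size_mark, Finset.mem_range]
  omega

-- The Hilbert space weight 2^{-n} balances creation (coefficient 1) and annihilation (coefficient
-- 1/4): both get the relative weight 1/2. This equality is what makes the degree changing part
-- skew.
open Classical in
theorem pow_card_toggleSet {A : Finset M.Pt} {p q : M.Pt} (hp : p ∈ A) (hpq : q ≠ p) :
    (1 / 2 : ℝ) ^ (M.toggleSet A p q).card * (if q ∈ A then 1 / 4 else 1) =
      (1 / 2 : ℝ) ^ A.card * (1 / 2) := by
  by_cases hq : q ∈ A
  · rw [if_pos hq, toggleSet, if_pos (Finset.mem_erase.mpr ⟨hpq, hq⟩),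
      ← Finset.card_erase_add_one hp, pow_succ]
    ring
  · rw [if_neg hq, toggleSet, if_neg fun h => hq (Finset.mem_of_mem_erase h),
      Finset.card_insert_of_notMem hq, pow_succ]
    ring

/-- The operator `genLE` describes the generator on the classes of the basis functions. -/
theorem toHilbLin_genCoeff {A : Finset M.Pt} {n : ℕ} (hn : A.card ≤ n) :
    M.toHilbLin (M.genCoeff A) = M.genLE n (M.toHilbLin (Finsupp.single A 1)) := by
  classical
  rcases A.eq_empty_or_nonempty with rfl | hA
  · rw [toHilbLin_single_empty, map_zero, genCoeff, Finset.sum_empty, map_zero]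
  refine ext_inner_left ℝ fun u => ?_
  rw [M.toHilbLin_single hA, mul_one, map_smul, inner_smul_right, inner_genLE,
    M.inner_liftLE_basisVec _ hA hn, M.inner_liftLE_basisVec _ hA hn, ← Finset.sum_add_distrib,
    genCoeff, ← Finset.sum_attach, map_sum, inner_sum, Finset.mul_sum]
  -- Both sides are now sums over the points of A, that is over its marks, and are compared mark by
  -- mark.
  refine Finset.sum_congr rfl fun ⟨p, hp⟩ _ => ?_
  have hnA : A.card ≤ n + 1 := hn.trans (Nat.le_succ n)
  have h1 : ∀ j : Fin d, ∀ s ∈ ({1, -1} : Finset ℤ), inner ℝ u (M.toHilbLin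
      (M.γ • (Finsupp.single (M.swapSet A p (M.shift (Pi.single j s) p)) 1 - Finsupp.single A 1) +
        (s * (p.2 : Fin d → ℝ) j) • Finsupp.single (M.toggleSet A p (M.shift (Pi.single j s) p))
            (if M.shift (Pi.single j s) p ∈ A then (1 / 4 : ℝ) else 1))) =
      (1 / 2 : ℝ) ^ A.card * (M.γ * (M.liftLE (n + 1) u (M.hop (Pi.single j s) (M.mark A p hp)) -
        M.liftLE (n + 1) u (M.mark A p hp)) +
        1 / 2 * s * (p.2 : Fin d → ℝ) j *
          M.liftLE (n + 1) u (M.toggle (Pi.single j s) (M.mark A p hp))) := by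
    intro j s hs
    have hne := M.shift_ne (single_ne_zero j hs) p
    obtain ⟨m1, e1⟩ := M.hop_mark (Pi.single j s) A p hp
    obtain ⟨m2, e2⟩ := M.toggle_mark (Pi.single j s) A p hp
    have hc : (M.toggleSet A p (M.shift (Pi.single j s) p)).card ≤ n + 1 := by
      rcases M.card_toggleSet hp hne with h | h <;> omega
    rw [e1, e2, M.liftLE_mark u _ (by rwa [card_swapSet]), M.liftLE_mark u _ hc,
      M.liftLE_mark u hp hnA, map_add, map_smul, map_sub, map_smul, inner_add_right,
      inner_smul_right, inner_smul_right, inner_sub_right, M.inner_toHilbLin_single u ⟨_, m1⟩,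
      M.inner_toHilbLin_single u hA, M.inner_toHilbLin_single u ⟨_, m2⟩, card_swapSet,
      M.pow_card_toggleSet hp hne]
    ring
  have h2 : ∀ q u' w, inner ℝ u (M.toHilbLin
      ((M.phiCoeff q u' * M.phiCoeff q w / M.phiNormSq q) •
      Finsupp.single (M.swapSet A (p.1, u') (p.1, w))
        (if (∀ p' ∈ A, p'.1 = p.1 → p' = p) ∧ p.2 = u' then (1 : ℝ) else 0))) =
      (1 / 2 : ℝ) ^ A.card * (M.phiCoeff q u' * M.phiCoeff q w / M.phiNormSq q *
        ((if M.Lone (M.mark A p hp) ∧ M.vel (M.mark A p hp) = u' then 1 else 0) *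
          M.liftLE (n + 1) u (M.relabel u' w (M.mark A p hp)))) := by
    intro q u' w
    obtain ⟨m, e⟩ := M.relabel_mark u' w A p hp
    rw [e, M.liftLE_mark u _ (by rwa [card_swapSet]), map_smul, inner_smul_right,
      M.inner_toHilbLin_single u ⟨_, m⟩, card_swapSet, M.lone_mark, M.vel_mark]
    ring_nf
  rw [map_sub, inner_sub_right, symOp_apply, skewOp_apply, sub_add_eq_add_sub, mul_sub]
  congr 1
  · simp only [map_sum, inner_sum]
    rw [Finset.mul_sum, ← Finset.sum_add_distrib, Finset.mul_sum]
    refine Finset.sum_congr rfl fun j _ => ?_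
    rw [Finset.mul_sum, ← Finset.sum_add_distrib, Finset.mul_sum]
    exact Finset.sum_congr rfl fun s hs => h1 j s hs
  · simp only [map_sum, inner_sum, Finset.mul_sum]
    exact Finset.sum_congr rfl fun q _ => Finset.sum_congr rfl fun u' _ =>
      Finset.sum_congr rfl fun w _ => h2 q u' w

theorem cut_toHilbLin_single {P : ℕ → Prop} {A : Finset M.Pt} (h : P A.card) (c : ℝ) :
    M.cut P (M.toHilbLin (Finsupp.single A c)) = M.toHilbLin (Finsupp.single A c) := by
  rcases A.eq_empty_or_nonempty with rfl | hA
  · rw [toHilbLin_single_empty, map_zero]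
  · rw [M.toHilbLin_single hA, map_smul, M.cut_basisVec (by rwa [deg_orb])]

theorem toHilbLin_genCoeffs (f : Finset M.Pt →₀ ℝ) : ∃ n,
    M.cut (· ≤ n) (M.toHilbLin f) = M.toHilbLin f ∧
      M.toHilbLin (M.genCoeffs f) = M.genLE n (M.toHilbLin f) := by
  have hf : f = ∑ A ∈ f.support, f A • Finsupp.single A (1 : ℝ) := by
    conv_lhs => rw [← Finsupp.sum_single f, Finsupp.sum]
    exact Finset.sum_congr rfl fun A _ => by rw [Finsupp.smul_single, smul_eq_mul, mul_one]
  obtain ⟨n, hn⟩ : ∃ n, ∀ A ∈ f.support, A.card ≤ n :=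
    ⟨f.support.sup Finset.card, fun A hA => Finset.le_sup (f := Finset.card) hA⟩
  refine ⟨n, ?_, ?_⟩
  · conv_lhs => rw [hf]
    conv_rhs => rw [hf]
    simp only [map_sum, map_smul]
    exact Finset.sum_congr rfl fun A hA => by rw [M.cut_toHilbLin_single (hn A hA)]
  · rw [genCoeffs, Finsupp.linearCombination_apply, Finsupp.sum]
    conv_rhs => rw [hf]
    simp only [map_sum, map_smul]
    exact Finset.sum_congr rfl fun A hA => by rw [M.toHilbLin_genCoeff (hn A hA)]

/-! ### The closed generator -/

/-- The graph of the generator on classes of local functions. -/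
def coreGraph : Submodule ℝ (M.Hilb × M.Hilb) :=
  LinearMap.range (M.toHilbLin.prod (M.toHilbLin.comp M.genCoeffs))

/-- Uniqueness of the Fourier coefficients makes `g` a linear function of `f`, so that the graph
before closure is a subspace. -/
theorem genGraph_eq : M.genGraph = (M.coreGraph.topologicalClosure : Set (M.Hilb × M.Hilb)) := by
  rw [Submodule.topologicalClosure_coe, genGraph]
  congr 1
  ext p
  constructor
  · rintro ⟨f, g, h, rfl⟩
    rw [← eval_genCoeffs] at h
    rw [M.eval_injective h]
    exact ⟨f, rfl⟩
  · rintro ⟨f, rfl⟩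
    exact ⟨f, _, M.eval_genCoeffs f, rfl⟩

theorem inner_nonpos_of_mem {p : M.Hilb × M.Hilb} (hp : p ∈ M.coreGraph.topologicalClosure) :
    inner ℝ p.1 p.2 ≤ 0 := by
  have hcl : IsClosed {p : M.Hilb × M.Hilb | inner ℝ p.1 p.2 ≤ 0} :=
    isClosed_le (continuous_fst.inner continuous_snd) continuous_const
  refine closure_minimal ?_ hcl hp
  rintro _ ⟨f, rfl⟩
  obtain ⟨n, h1, h2⟩ := M.toHilbLin_genCoeffs f
  change inner ℝ (M.toHilbLin f) (M.toHilbLin (M.genCoeffs f)) ≤ 0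
  rw [h2]
  exact M.inner_genLE_nonpos h1

theorem basisVec_mem {o : M.Orbit} {n : ℕ} (h : M.deg o ≤ n) :
    (M.basisVec o, M.genLE n (M.basisVec o)) ∈ M.coreGraph := by
  obtain ⟨A, hA, rfl⟩ := M.exists_orb o
  have h1 : M.toHilbLin (Finsupp.single A ((2 : ℝ) ^ A.card)) = M.basisVec (M.orb A hA) := by
    rw [M.toHilbLin_single hA, ← mul_pow]
    norm_num
  refine ⟨Finsupp.single A ((2 : ℝ) ^ A.card), ?_⟩
  refine Prod.ext h1 ?_
  change M.toHilbLin (M.genCoeffs _) = M.genLE n (M.basisVec (M.orb A hA))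
  rw [← h1, genCoeffs, Finsupp.linearCombination_single, map_smul,
    M.toHilbLin_genCoeff (n := n) h, ← map_smul, ← map_smul, Finsupp.smul_single, smul_eq_mul,
    mul_one]

/-- All functions of bounded degree are in the domain of the closed generator. -/
theorem genLE_mem {n : ℕ} {u : M.Hilb} (hu : M.cut (· ≤ n) u = u) :
    (u, M.genLE n u) ∈ M.coreGraph.topologicalClosure := by
  classical
  have h1 : HasSum (fun o => u o • M.basisVec o) u := by
    convert lp.hasSum_single (p := 2) (by norm_num) u using 2 with o
    rw [basisVec, ← lp.single_smul, smul_eq_mul, mul_one]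
  have h2 : HasSum (fun o => (u o • M.basisVec o, M.genLE n (u o • M.basisVec o)))
      (u, M.genLE n u) :=
    h1.prodMk (h1.mapL (M.genLE n))
  -- Partial sums of the basis expansion lie in the core, and `genLE n` is continuous; coefficients
  -- of degree above `n` vanish by `hu`.
  refine M.coreGraph.isClosed_topologicalClosure.mem_of_tendsto h2
    (Filter.Eventually.of_forall fun s => Submodule.sum_mem _ fun o _ => ?_)
  refine M.coreGraph.le_topologicalClosure ?_
  by_cases ho : M.deg o ≤ n
  · have := M.coreGraph.smul_mem (u o) (M.basisVec_mem ho)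
    rwa [Prod.smul_mk, ← map_smul] at this
  · have h0 : u o = 0 := by rw [← hu, cut_apply, if_neg ho]
    rw [h0, zero_smul, map_zero]
    exact Submodule.zero_mem _

/-- A densely defined dissipative operator is closable: if (0, y) lies in the closed graph,
dissipativity of t (e, L e) + (0, y) for all real t forces y to be orthogonal to each basis vector
e. -/
theorem eq_of_mem {a b c : M.Hilb} (hb : (a, b) ∈ M.coreGraph.topologicalClosure)
    (hc : (a, c) ∈ M.coreGraph.topologicalClosure) : b = c := by
  rw [← sub_eq_zero]
  have h0 : ((0 : M.Hilb), b - c) ∈ M.coreGraph.topologicalClosure := by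
    have := Submodule.sub_mem _ hb hc
    rwa [Prod.mk_sub_mk, sub_self] at this
  ext o
  rw [← inner_basisVec]
  have h1 := M.coreGraph.le_topologicalClosure (M.basisVec_mem (o := o) le_rfl)
  have h2 : ∀ t : ℝ, t ^ 2 * inner ℝ (M.basisVec o) (M.genLE (M.deg o) (M.basisVec o)) +
      t * inner ℝ (b - c) (M.basisVec o) ≤ 0 := fun t => by
    have h3 := M.inner_nonpos_of_mem (Submodule.add_mem _ (Submodule.smul_mem _ t h1) h0)
    simp only [Prod.smul_mk, Prod.mk_add_mk, add_zero, inner_add_right, inner_smul_left,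
      inner_smul_right, RCLike.conj_to_real] at h3
    rw [real_inner_comm (M.basisVec o)]
    linarith
  have h3 := M.inner_nonpos_of_mem h1
  simp only at h3
  change inner ℝ (b - c) (M.basisVec o) = 0
  set x := inner ℝ (M.basisVec o) (M.genLE (M.deg o) (M.basisVec o))
  set y := inner ℝ (b - c) (M.basisVec o)
  -- For this t one has y = t (1 - x), and t² x + t y becomes t².
  have h4 := h2 (y / (1 - x))
  have h5 : 0 < 1 - x := by linarith
  have h6 : (y / (1 - x)) ^ 2 * x + y / (1 - x) * y = (y / (1 - x)) ^ 2 := by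
    field_simp
    ring
  rw [h6] at h4
  have h7 : y / (1 - x) = 0 := by
    have := le_antisymm h4 (sq_nonneg _)
    exact pow_eq_zero_iff (two_ne_zero) |>.mp this
  exact (div_eq_zero_iff.mp h7).resolve_right h5.ne'

/-! ### Density of the range -/

theorem norm_sq_cut_succ (n : ℕ) (w : M.Hilb) :
    ‖M.cut (· = n + 1) w‖ ^ 2 = ‖M.cut (· ≤ n + 1) w‖ ^ 2 - ‖M.cut (· ≤ n) w‖ ^ 2 := by
  have h1 : ∀ P : ℕ → Prop, ‖M.cut P w‖ ^ 2 = inner ℝ w (M.cut P w) := fun P => by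
    rw [← real_inner_self_eq_norm_sq, inner_cut, cut_cut]
    simp only [and_self]
  rw [h1, h1, h1, ← inner_sub_right]
  congr 1
  ext o
  rw [lp.coeFn_sub, Pi.sub_apply, cut_apply, cut_apply, cut_apply]
  split_ifs <;> first | omega | simp

theorem norm_sq_lift_singleton_le (n : ℕ) (w : M.Hilb) :
    ‖M.lift {n} w‖ ^ 2 ≤ n * ‖M.cut (· = n) w‖ ^ 2 := by
  classical
  have h1 : M.lift {n} w = M.lift {n} (M.cut (· = n) w) := by
    ext k
    rw [lift_cut_apply, lift_apply]
    simp only [Finset.mem_singleton]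
    split_ifs <;> rfl
  rw [h1]
  refine (norm_sq_pull_le _ _ _ _ _).trans ?_
  simp

/-- The skew form of the component of degree at most `n` with itself vanishes; only the flux across
the cut remains. -/
theorem inner_skewOp_liftLE (n : ℕ) (w : M.Hilb) :
    inner ℝ (M.skewOp (M.liftLE (n + 1) w)) (M.liftLE n w) =
      inner ℝ (M.skewOp (M.lift {n + 1} w)) (M.lift {n} w) := by
  have h1 : M.liftLE (n + 1) w = M.liftLE n w + M.lift {n + 1} w := by
    ext k
    rw [lp.coeFn_add, Pi.add_apply, lift_apply, lift_apply, lift_apply]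
    simp only [Finset.mem_range, Finset.mem_singleton]
    split_ifs <;> first | omega | simp
  rw [h1, map_add, inner_add_left, inner_skewOp_self, zero_add]
  refine inner_congr fun k => ?_
  rcases lt_trichotomy (M.size k) n with hk | hk | hk
  · rw [M.skewOp_congr (h' := 0), map_zero]
    · simp
    · intro k' hk'
      rw [lift_apply_of_notMem]
      · rfl
      · rw [Finset.mem_singleton]; omega
  · rw [lift_apply_of_mem, lift_apply_of_mem]
    · rw [Finset.mem_singleton]; omega
    · rw [Finset.mem_range]; omega
  · rw [lift_apply_of_notMem, lift_apply_of_notMem]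
    · rw [Finset.mem_singleton]; omega
    · rw [Finset.mem_range]; omega

theorem inner_symOp_liftLE (n : ℕ) (w : M.Hilb) :
    inner ℝ (M.symOp (M.liftLE (n + 1) w)) (M.liftLE n w) ≤ 0 := by
  have : inner ℝ (M.symOp (M.liftLE (n + 1) w)) (M.liftLE n w) =
      inner ℝ (M.symOp (M.liftLE n w)) (M.liftLE n w) := by
    refine inner_congr fun k => ?_
    by_cases hk : M.size k ∈ Finset.range (n + 1)
    · congr 1
      refine M.symOp_congr fun k' hk' => ?_
      rw [Finset.mem_range] at hk
      rw [lift_apply_of_mem, lift_apply_of_mem] <;> (rw [Finset.mem_range]; omega)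
    · rw [M.lift_apply_of_notMem w hk, mul_zero, mul_zero]
  rw [this, inner_symOp]
  exact M.inner_symOp_nonpos _

/-- The range of `lam - L` on functions of bounded degree is dense. -/
theorem eq_zero_of_orthogonal {lam : ℝ} (hlam : 0 < lam) {w : M.Hilb}
    (hw : ∀ n u, M.cut (· ≤ n) u = u → inner ℝ w (lam • u - M.genLE n u) = 0) : w = 0 := by
  classical
  let p : ℕ → ℝ := fun n => ‖M.cut (· ≤ n) w‖ ^ 2
  have hmono : Monotone p := monotone_nat_of_le_succ fun n => by
    have := M.norm_sq_cut_succ n w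
    have h2 := sq_nonneg ‖M.cut (· = n + 1) w‖
    change ‖M.cut (· ≤ n) w‖ ^ 2 ≤ ‖M.cut (· ≤ n + 1) w‖ ^ 2
    linarith
  have hbd : ∀ n, p n ≤ ‖w‖ ^ 2 := fun n => by
    have := M.norm_cut_le (· ≤ n) w
    change ‖M.cut (· ≤ n) w‖ ^ 2 ≤ ‖w‖ ^ 2
    gcongr
  have hp : ∀ n, p (n + 1) ≤ ‖M.skewOp‖ / lam * (n + 1) * (p (n + 2) - p n) := by
    intro n
    -- The trial function is the projection of w itself.
    have h1 := hw (n + 1) (M.cut (· ≤ n + 1) w) (by rw [cut_cut]; simp only [and_self])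
    rw [genLE_cut, inner_sub_right, inner_smul_right, inner_genLE, inner_skewOp_liftLE] at h1
    have h2 : inner ℝ w (M.cut (· ≤ n + 1) w) = p (n + 1) := by
      change _ = ‖M.cut (· ≤ n + 1) w‖ ^ 2
      rw [← real_inner_self_eq_norm_sq, inner_cut, cut_cut]
      simp only [and_self]
    have h3 := M.inner_symOp_liftLE (n + 1) w
    have h4 := real_inner_le_norm (M.skewOp (M.lift {n + 1 + 1} w)) (M.lift {n + 1} w)
    have h5 := M.skewOp.le_opNorm (M.lift {n + 1 + 1} w)
    have h6 := M.norm_sq_lift_singleton_le (n + 1) w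
    have h7 := M.norm_sq_lift_singleton_le (n + 1 + 1) w
    have h8 : ‖M.cut (· = n + 1) w‖ ^ 2 = p (n + 1) - p n := M.norm_sq_cut_succ n w
    have h9 : ‖M.cut (· = n + 1 + 1) w‖ ^ 2 = p (n + 2) - p (n + 1) := M.norm_sq_cut_succ (n + 1) w
    rw [h8] at h6
    rw [h9] at h7
    rw [h2] at h1
    push_cast at h6 h7
    set a := ‖M.lift {n + 1} w‖
    set b := ‖M.lift {n + 1 + 1} w‖
    have ha : 0 ≤ a := norm_nonneg _
    have h10 : ‖M.skewOp (M.lift {n + 1 + 1} w)‖ * a ≤ ‖M.skewOp‖ * b * a := by gcongr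
    -- From ab ≤ (a² + b²)/2, the bounds `h6`, `h7` with factors n+1 and n+2, and n + 2 ≤ 2(n + 1).
    have h11 : b * a ≤ (n + 1) * (p (n + 2) - p n) := by
      have m1 := hmono (Nat.le_succ n)
      have m2 := hmono (Nat.le_succ (n + 1))
      have m3 : (0 : ℝ) ≤ n := Nat.cast_nonneg n
      simp only [Nat.succ_eq_add_one] at m1 m2
      rw [show n + 1 + 1 = n + 2 from rfl] at m2
      nlinarith [sq_nonneg (a - b), mul_nonneg m3 (sub_nonneg.mpr m1),
        mul_nonneg m3 (sub_nonneg.mpr m2)]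
    have h12 : ‖M.skewOp‖ * b * a ≤ ‖M.skewOp‖ * ((n + 1) * (p (n + 2) - p n)) := by
      rw [mul_assoc]
      gcongr
    have h13 : lam * p (n + 1) ≤ ‖M.skewOp‖ * ((n + 1) * (p (n + 2) - p n)) := by linarith
    rw [← le_div_iff₀' hlam] at h13
    refine h13.trans (le_of_eq ?_)
    ring
  have h0 := eq_zero_of_carleman hmono (fun n => sq_nonneg _) hbd hp
  ext o
  have h1 : M.cut (· ≤ M.deg o) w = 0 := by
    have := h0 (M.deg o)
    simpa [p] using this
  have h2 : M.cut (· ≤ M.deg o) w o = w o := by rw [cut_apply, if_pos le_rfl]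
  rw [← h2, h1]

/-! ### The truncated resolvents -/

theorem cut_le_genLE {n m : ℕ} (h : n + 1 ≤ m) (u : M.Hilb) :
    M.cut (· ≤ m) (M.genLE n u) = M.genLE n u := by
  refine ext_inner_left ℝ fun w => ?_
  have h1 : M.liftLE (n + 1) (M.cut (· ≤ m) w) = M.liftLE (n + 1) w := by
    ext k
    rw [lift_cut_apply, lift_apply]
    simp only [Finset.mem_range]
    split_ifs <;> first | rfl | omega
  rw [← inner_cut, inner_genLE, inner_genLE, h1]

/-- P_n a is always in the domain of the closed generator (`genLE_mem`), and the value there is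
unique (`eq_of_mem`). -/
theorem mem_truncGraph {n : ℕ} {a b : M.Hilb} :
    (a, b) ∈ M.truncGraph n ↔ b = M.symTrunc n a + M.skewTrunc n a := by
  have hmem := M.genLE_mem (n := n) (u := M.cut (· ≤ n) a) (by rw [cut_cut]; simp only [and_self])
  rw [genLE_cut] at hmem
  rw [truncGraph, Set.mem_ofPred_eq, genGraph_eq]
  simp only [proj_eq_cut, SetLike.mem_coe]
  constructor
  · rintro ⟨w, h1, h2⟩
    rw [h2, M.eq_of_mem h1 hmem, cut_genLE]
  · intro h
    exact ⟨_, hmem, by rw [h, cut_genLE]⟩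

theorem inner_trunc_nonpos (n : ℕ) (u : M.Hilb) :
    inner ℝ u ((M.symTrunc n + M.skewTrunc n) u) ≤ 0 := by
  rw [add_apply, inner_add_right, inner_skewTrunc, inner_skewOp_self, add_zero]
  exact M.symTrunc_nonpos n u

/-- The class of the current has degree two: its part of degree one is a gradient. -/
theorem cut_toHilb_sigmaCoeff (θ : Fin d → ℝ) (r : Fin (d + 1) → ℝ) {P : ℕ → Prop} (h : P 2) :
    M.cut P (M.toHilb (M.sigmaCoeff θ r)) = M.toHilb (M.sigmaCoeff θ r) := by
  rw [← toHilbLin_apply, sigmaCoeff]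
  simp only [map_sum, map_smul]
  refine Finset.sum_congr rfl fun a _ => Finset.sum_congr rfl fun j _ => ?_
  congr 1
  refine Finset.sum_congr rfl fun v _ => ?_
  have h1 : ∀ c : ℝ, M.toHilbLin (Finsupp.single {(Pi.single j 1, v)} c) =
      M.toHilbLin (Finsupp.single {(0, v)} c) := by
    intro c
    rw [M.toHilbLin_single (Finset.singleton_nonempty _),
      M.toHilbLin_single (Finset.singleton_nonempty _), Finset.card_singleton,
      Finset.card_singleton]
    congr 2
    rw [orb_eq_orb]
    refine ⟨Pi.single j 1, ?_⟩
    rw [translate_eq_map, Finset.map_singleton]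
    simp [shift_apply]
  rw [map_add, map_sub, h1, sub_self, zero_add, M.cut_toHilbLin_single]
  rw [Finset.card_pair]
  · exact h
  · intro h'
    simpa using congrFun (congrArg Prod.fst h') j

/-! ### Parity splitting and monotonicity of the truncations -/

/-- The even and the odd part of a solution of a truncated resolvent equation. -/
theorem parity_equations {n : ℕ} {lam : ℝ} {σ u : M.Hilb} (hσ : M.cut Even σ = σ)
    (hu : lam • u - σ = M.symTrunc n u + M.skewTrunc n u) :
    lam • M.cut Even u - M.symTrunc n (M.cut Even u) -
        M.skewTrunc n (M.cut (fun k => ¬Even k) u) = σ ∧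
      lam • M.cut (fun k => ¬Even k) u - M.symTrunc n (M.cut (fun k => ¬Even k) u) -
        M.skewTrunc n (M.cut Even u) = 0 := by
  have hσ' : M.cut (fun k => ¬Even k) σ = 0 := by
    have := M.cut_add_cut_not Even σ
    rw [hσ] at this
    simpa using this
  have h1 := congrArg (M.cut Even) hu
  have h2 := congrArg (M.cut fun k => ¬Even k) hu
  rw [map_sub, map_smul, map_add, cut_symTrunc, hσ,
    M.cut_skewTrunc (P' := fun k => ¬Even k) (fun k => Nat.even_add_one)
      (fun k => by rw [Nat.even_add_one, not_not])] at h1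
  rw [map_sub, map_smul, map_add, cut_symTrunc, hσ',
    M.cut_skewTrunc (P' := Even) (fun k => by rw [Nat.even_add_one, not_not])
      (fun k => Nat.even_add_one)] at h2
  constructor
  · rw [sub_sub, ← h1, sub_sub_cancel]
  · rw [sub_sub, ← h2, sub_zero, sub_self]

theorem cut_le_of_equation {n : ℕ} {lam : ℝ} (hlam : 0 < lam) {σ u : M.Hilb}
    (hσ : M.cut (· ≤ n) σ = σ) (hu : lam • u - σ = M.symTrunc n u + M.skewTrunc n u) :
    M.cut (· ≤ n) u = u := by
  have h1 : M.cut (· ≤ n) (lam • u) = lam • u := by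
    rw [sub_eq_iff_eq_add] at hu
    rw [hu, ← cut_genLE, map_add, cut_cut, hσ]
    simp only [and_self]
  rw [map_smul] at h1
  exact smul_right_injective _ hlam.ne' h1

/-- The component whose parity excludes the last degree n+1 stops at degree n, so its image under
the skew part is not truncated. -/
theorem cut_pred {n : ℕ} {P : ℕ → Prop} (hn : ¬P (n + 1)) {u : M.Hilb}
    (hu : M.cut (· ≤ n + 1) u = u) : M.cut (· ≤ n) (M.cut P u) = M.cut P u := by
  ext o
  by_cases hP : P (M.deg o)
  · by_cases h1 : M.deg o ≤ n
    · simp only [cut_apply, hP, h1, if_true]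
    · have h2 : M.deg o ≠ n + 1 := fun h => hn (h ▸ hP)
      have h3 : u o = 0 := by
        rw [← hu, cut_apply, if_neg]
        omega
      simp only [cut_apply, h3, ite_self]
  · simp only [cut_apply, hP, if_false, ite_self]

theorem cut_comm (P P' : ℕ → Prop) (u : M.Hilb) : M.cut P (M.cut P' u) = M.cut P' (M.cut P u) := by
  rw [cut_cut, cut_cut]
  simp only [and_comm]

theorem inner_cut_even {σ : M.Hilb} (hσ : M.cut Even σ = σ) (u : M.Hilb) :
    inner ℝ σ (M.cut Even u) = inner ℝ σ u := by
  rw [← inner_cut, hσ]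

theorem inner_le_of_odd {n m : ℕ} (hn : ¬Even (n + 1)) (hm : n + 1 ≤ m) {lam : ℝ} (hlam : 0 < lam)
    {σ u u' : M.Hilb} (hσ : M.cut Even σ = σ) (hσn : M.cut (· ≤ n + 1) σ = σ)
    (hu : lam • u - σ = M.symTrunc (n + 1) u + M.skewTrunc (n + 1) u)
    (hu' : lam • u' - σ = M.symTrunc m u' + M.skewTrunc m u') :
    inner ℝ σ u ≤ inner ℝ σ u' := by
  obtain ⟨h1, h2⟩ := M.parity_equations hσ hu'
  obtain ⟨h3, h4⟩ := M.parity_equations hσ hu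
  have hc := M.cut_le_of_equation hlam hσn hu
  have hf : M.cut (· ≤ n + 1) (M.cut Even u) = M.cut Even u := by rw [cut_comm, hc]
  have hg : M.cut (· ≤ n + 1) (M.cut (fun k => ¬Even k) u) = M.cut (fun k => ¬Even k) u := by
    rw [cut_comm, hc]
  rw [← M.inner_cut_even hσ u, ← M.inner_cut_even hσ u']
  -- As n+1 is odd, the even part stops at degree n: the odd equation `h4` is the same at level m,
  -- and only the skew term of `h3` is truncated.
  rw [← M.symTrunc_eq hm hf] at h3
  rw [← M.symTrunc_eq hm hg, ← M.skewTrunc_eq (Nat.lt_succ_self n) hm (M.cut_pred hn hc)] at h4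
  exact inner_le_of_odd_truncation (M.symTrunc_symm m) (M.symTrunc_nonpos m) (M.skewTrunc_skew m)
    hlam.le h1 h2 h3 h4 (M.inner_skewTrunc_eq hm hg hf)

theorem inner_le_of_even {n m : ℕ} (hn : Even (n + 1)) (hm : n + 1 ≤ m) {lam : ℝ} (hlam : 0 < lam)
    {σ u u' : M.Hilb} (hσ : M.cut Even σ = σ) (hσn : M.cut (· ≤ n + 1) σ = σ)
    (hu : lam • u - σ = M.symTrunc (n + 1) u + M.skewTrunc (n + 1) u)
    (hu' : lam • u' - σ = M.symTrunc m u' + M.skewTrunc m u') :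
    inner ℝ σ u' ≤ inner ℝ σ u := by
  obtain ⟨h1, h2⟩ := M.parity_equations hσ hu'
  obtain ⟨h3, h4⟩ := M.parity_equations hσ hu
  have hc := M.cut_le_of_equation hlam hσn hu
  have hf : M.cut (· ≤ n + 1) (M.cut Even u) = M.cut Even u := by rw [cut_comm, hc]
  have hg : M.cut (· ≤ n + 1) (M.cut (fun k => ¬Even k) u) = M.cut (fun k => ¬Even k) u := by
    rw [cut_comm, hc]
  rw [← M.inner_cut_even hσ u, ← M.inner_cut_even hσ u']
  -- As n+1 is even, the odd part stops at degree n: now the even equation `h3` is the same at level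
  -- m, and the skew term of `h4` is truncated.
  rw [← M.symTrunc_eq hm hf, ← M.skewTrunc_eq (Nat.lt_succ_self n) hm
    (M.cut_pred (P := fun k => ¬Even k) (not_not.mpr hn) hc)] at h3
  rw [← M.symTrunc_eq hm hg] at h4
  exact inner_le_of_even_truncation (M.symTrunc_symm m) (M.symTrunc_nonpos m) (M.skewTrunc_skew m)
    hlam.le h1 h2 h3 h4 (M.inner_skewTrunc_eq hm hf hg)

end

end LatticeGas

/-! ### Existence, convergence and monotonicity assembled -/

theorem lemma4p1 {d : ℕ} (M : LatticeGas d) (θ : Fin d → ℝ) (r : Fin (d + 1) → ℝ)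
    (lam : ℝ) (hlam : 0 < lam) :
    ∃ (Rtrunc : ℕ → M.Hilb →L[ℝ] M.Hilb) (R : M.Hilb →L[ℝ] M.Hilb),
      (∀ n, M.IsResolvent (M.truncGraph n) lam (Rtrunc n)) ∧
      M.IsResolvent M.genGraph lam R ∧
      (let σ : M.Hilb := M.toHilb (M.sigmaCoeff θ r)
       Monotone (fun k : ℕ => inner ℝ σ (Rtrunc (2 * (k + 1) + 1) σ)) ∧
       Filter.Tendsto (fun k : ℕ => inner ℝ σ (Rtrunc (2 * (k + 1) + 1) σ)) Filter.atTop
         (nhds (inner ℝ σ (R σ))) ∧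
       Antitone (fun k : ℕ => inner ℝ σ (Rtrunc (2 * (k + 1)) σ)) ∧
       Filter.Tendsto (fun k : ℕ => inner ℝ σ (Rtrunc (2 * (k + 1)) σ)) Filter.atTop
         (nhds (inner ℝ σ (R σ)))) := by
  choose Rn hRn using fun n =>
    exists_resolvent_of_bounded (M.symTrunc n + M.skewTrunc n) (M.inner_trunc_nonpos n) hlam
  obtain ⟨R, hR⟩ := exists_resolvent M.coreGraph.topologicalClosure
    M.coreGraph.isClosed_topologicalClosure (fun p hp => M.inner_nonpos_of_mem hp) hlam
    (fun w hw => M.eq_zero_of_orthogonal hlam fun n u hu => hw _ (M.genLE_mem hu))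
  have hRn' : ∀ n s, lam • Rn n s - s = M.symTrunc n (Rn n s) + M.skewTrunc n (Rn n s) :=
    fun n s => (hRn n s (Rn n s)).mpr rfl
  have hb : ∀ x s : M.Hilb, lam * ‖x‖ ≤ ‖s‖ → ‖x‖ ≤ lam⁻¹ * ‖s‖ := fun x s h => by
    rwa [← div_eq_inv_mul, le_div_iff₀' hlam]
  have hbn : ∀ n s, ‖Rn n s‖ ≤ lam⁻¹ * ‖s‖ := fun n s => hb _ _ <| norm_le_of_dissipative <| by
    rw [hRn' n s]
    exact M.inner_trunc_nonpos n _
  have hbR : ∀ s, ‖R s‖ ≤ lam⁻¹ * ‖s‖ := fun s => hb _ _ <| norm_le_of_dissipative <|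
    M.inner_nonpos_of_mem ((hR s (R s)).mpr rfl)
  let D : Submodule ℝ M.Hilb :=
    Submodule.span ℝ {h | ∃ n u, M.cut (· ≤ n) u = u ∧ h = lam • u - M.genLE n u}
  have hD : Dᗮ = ⊥ := by
    rw [Submodule.eq_bot_iff]
    intro w hw
    rw [Submodule.mem_orthogonal'] at hw
    exact M.eq_zero_of_orthogonal hlam fun n u hu => hw _ (Submodule.subset_span ⟨n, u, hu, rfl⟩)
  have hDR : ∀ h ∈ D, ∃ N, ∀ n ≥ N, Rn n h = R h := by
    intro h hh
    induction hh using Submodule.span_induction with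
    | mem h hh =>
      obtain ⟨n, u, hu, rfl⟩ := hh
      -- The image of u under L has degree at most n+1, so for m ≥ n+1 the truncation does not act
      -- and u solves both resolvent equations.
      refine ⟨n + 1, fun m hm => ?_⟩
      have e1 : u = R (lam • u - M.genLE n u) := by
        rw [← hR, sub_sub_cancel]
        exact M.genLE_mem hu
      have e2 : u = Rn m (lam • u - M.genLE n u) := by
        rw [← hRn, sub_sub_cancel, add_apply, ← M.cut_genLE, M.genLE_eq (m := m) (by omega) hu,
          M.cut_le_genLE hm]
      rw [← e1, ← e2]
    | zero => exact ⟨0, fun n _ => by rw [map_zero, map_zero]⟩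
    | add x y _ _ hx hy =>
      obtain ⟨N, hN⟩ := hx
      obtain ⟨N', hN'⟩ := hy
      refine ⟨max N N', fun n hn => ?_⟩
      rw [map_add, map_add, hN n (le_of_max_le_left hn), hN' n (le_of_max_le_right hn)]
    | smul c x _ hx =>
      obtain ⟨N, hN⟩ := hx
      exact ⟨N, fun n hn => by rw [map_smul, map_smul, hN n hn]⟩
  have hconv := fun s => tendsto_of_eventually_eq hbn hbR D hD hDR s
  refine ⟨Rn, R, fun n s u => ?_, fun s u => ?_, ?_⟩
  · rw [M.mem_truncGraph, ← hRn]
    rfl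
  · rw [M.genGraph_eq, SetLike.mem_coe, hR]
  intro σ
  have hσ : M.cut Even σ = σ := M.cut_toHilb_sigmaCoeff θ r even_two
  have hσn : ∀ n, 2 ≤ n → M.cut (· ≤ n) σ = σ := fun n hn => M.cut_toHilb_sigmaCoeff θ r hn
  have hlim : Filter.Tendsto (fun n => inner ℝ σ (Rn n σ)) Filter.atTop (nhds (inner ℝ σ (R σ))) :=
    Filter.Tendsto.inner tendsto_const_nhds (hconv σ)
  -- The index k + 1 ≥ 1 ensures that every truncation level is at least 2, the degree of σ.
  refine ⟨fun k l hkl => ?_, hlim.comp ?_, fun k l hkl => ?_, hlim.comp ?_⟩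
  · exact M.inner_le_of_odd (n := 2 * (k + 1)) (by simp) (by omega) hlam hσ
      (hσn _ (by omega)) (hRn' _ σ) (hRn' _ σ)
  · exact Filter.tendsto_atTop_mono (fun k => (by omega : k ≤ 2 * (k + 1) + 1)) Filter.tendsto_id
  · exact M.inner_le_of_even (n := 2 * k + 1) ⟨k + 1, by omega⟩ (by omega) hlam hσ
      (hσn _ (by omega)) (hRn' _ σ) (hRn' _ σ)
  · exact Filter.tendsto_atTop_mono (fun k => (by omega : k ≤ 2 * (k + 1))) Filter.tendsto_id
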